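/- **Notation.** $\mathbb N=\{1,2,\dots\}$. For a finite connected simple graph $\mathbb G=(V,E)$ with graph distance $d_{\mathbb G}$, let $B_{d_{\mathbb G}}(x,R)=\{y: d_{\mathbb G}(x,y)<R\}$, and for $A\subseteq V$, $f:V\to\mathbb R$ let $\mathcal E^{\mathbb G}_{p,A}(f)=\sum_{\{x,y\}\in E,\ x,y\in A}|f(x)-f(y)|^p$, $\mathcal E^{\mathbb G}_p=\mathcal E^{\mathbb G}_{p,V}$; $f_B$ is the average of $f$ over $B$ (with respect to the counting measure on a finite set $B$). **Setting.** Let $p\in(1,\infty)$, $d_{\mathrm f}\in[1,\infty)$, $\beta>0$, $\vartheta\in(0,1]$, $R_*\in(1,\infty)$, and let $C_{\mathrm{AR}},C_0,C_{\mathrm{PI}},A_{\mathrm{PI}}\ge 1$, $A_1,A_2>1$, $C_*>0$. Let $(K,d)$ be a connected compact metric space with at least two points, and let $m$ be a Borel probability measure on $K$ with $C_{\mathrm{AR}}^{-1}r^{d_{\mathrm f}}\le m(B_d(x,r))\le C_{\mathrm{AR}}r^{d_{\mathrm f}}$ for all $x\in K$, $0<r<\operatorname{diam}(K,d)$. Let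 $\mathbb G_n=(V_n,E_n)$, $n\in\mathbb N$, be finite connected simple graphs with graph distances $d_n$, and let $\pi_{n,k}:V_n\to V_k$ $(1\le k<n)$ be surjective maps with $\pi_{l,k}=\pi_{n,k}\circ\pi_{l,n}$ for $k<n<l$. Assume: 1. ($R_*$-scaled) for all $n,k\in\mathbb N$ there are points $c_n(w)\in V_{n+k}$ $(w\in V_k)$ with $B_{d_{n+k}}(c_n(w),A_1^{-1}R_*^n)\subseteq\pi_{n+k,k}^{-1}(w)\subseteq B_{d_{n+k}}(c_n(w),A_1R_*^n)$ for all $w\in V_k$, and $d_{n+k}(c_n(w),c_n(w'))\le A_2R_*^n$ whenever $d_k(w,w')=1$; 2. ($R_*$-compatible) there are maps $p_n:V_n\to K$ and Borel sets $\widetilde K_v\subseteq K$ $(v\in V_n,\ n\in\mathbb N)$ such that for all $n$: $C_0^{-1}d_n(x,y)R_*^{-n}\le d(p_n(x),p_n(y))\le C_0\,d_n(x,y)R_*^{-n}$ for $x,y\in V_n$; the sets $(\widetilde K_v)_{v\in V_n}$ partition $K$; $\widetilde K_v=\bigcup_{w\in\pi_{n,k}^{-1}(v)}\widetilde K_w$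 for $1\le k<n$, $v\in V_k$; and $B_d(p_n(v),C_0^{-1}R_*^{-n})\subseteq\widetilde K_v\subseteq B_d(p_n(v),C_0R_*^{-n})$ for $v\in V_n$. Fix such maps and sets; 3. (uniform Poincaré inequality) $\sum_{y\in B}|f(y)-f_B|^p\le C_{\mathrm{PI}}R^\beta\,\mathcal E^{\mathbb G_n}_{p,B_{d_n}(x,A_{\mathrm{PI}}R)}(f)$ with $B=B_{d_n}(x,R)$, for all $n\in\mathbb N$, $x\in V_n$, $R\ge1$, $f:V_n\to\mathbb R$; 4. (uniform cut-off functions) for all $n\in\mathbb N$, $v\in V_n$, $R\ge 1$ there is $\varphi:V_n\to[0,1]$ with $\varphi=1$ on $B_{d_n}(v,R)$, $\varphi=0$ off $B_{d_n}(v,2R)$, $\mathcal E^{\mathbb G_n}_p(\varphi)\le C_*\,\#B_{d_n}(v,R)/R^\beta$, and $|\varphi(x)-\varphi(y)|\le C_*(d_n(x,y)/R)^\vartheta$ for all $x,y\in V_n$. For $f\in L^p(K,m)$ put $M_nf(v)=m(\widetilde K_v)^{-1}\int_{\widetilde K_v}f\,dm$ for $v\in V_n$, $\widetilde{\mathcal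 E}^{(n)}_p(f)=R_*^{n(\beta-d_{\mathrm f})}\mathcal E^{\mathbb G_n}_p(M_nf)$, $|f|_{\mathcal F_p}=\bigl(\sup_{n\in\mathbb N}\widetilde{\mathcal E}^{(n)}_p(f)\bigr)^{1/p}\in[0,\infty]$, and $\mathcal F_p=\{f\in L^p(K,m): |f|_{\mathcal F_p}<\infty\}$. For $b,r>0$ put $$\mathrm{KS}_{b,r}(f)=\int_K\frac1{m(B_d(x,r))}\int_{B_d(x,r)}\frac{|f(x)-f(y)|^p}{r^{b}}\,m(dy)\,m(dx)\in[0,\infty].$$ For $s>0$ let $B^s_{p,\infty}=\{f\in L^p(K,m):\sup_{0<r\le\operatorname{diam}(K,d)}\mathrm{KS}_{sp,r}(f)<\infty\}$, and let $s_p=\sup\{s>0: B^s_{p,\infty}\text{ contains a function that is not } m\text{-a.e. constant}\}$. **Theorem 7.1.** There is a constant $C\ge1$, depending only on $p,d_{\mathrm f},\beta,\vartheta,R_*,C_{\mathrm{AR}},A_1,A_2,C_0,C_{\mathrm{PI}},A_{\mathrm{PI}},C_*$, such that for all $f\in L^p(K,m)$ $$C^{-1}|f|_{\mathcal F_p}^p\le\liminf_{r\downarrow0}\mathrm{KS}_{\beta,r}(f)\le\sup_{r>0}\mathrm{KS}_{\beta,r}(f)\le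 C|f|_{\mathcal F_p}^p .$$ In particular $\mathcal F_p=B^{\beta/p}_{p,\infty}$, and $\sup_{r>0}\mathrm{KS}_{\beta,r}(f)\le C^2\liminf_{r\downarrow0}\mathrm{KS}_{\beta,r}(f)$ for all $f\in L^p(K,m)$. Moreover $s_p=\beta/p$. -/

import Mathlib

open MeasureTheory Filter Topology
open scoped ENNReal

namespace GraphSobolev

/-! ### Finite graphs -/

section Graph

variable {V : Type*} [Fintype V]

open Classical in
/-- The open ball `B(x, R) = {y | d(x, y) < R}` of a finite graph for the graph distance. -/
noncomputable def graphBall (G : SimpleGraph V) (x : V) (R : ℝ) : Finset V :=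
  Finset.univ.filter fun y => (G.dist x y : ℝ) < R

open Classical in
/-- The discrete `p`-energy `∑_{ {x,y} ∈ E(A) } |f x - f y| ^ p`, where `E(A)` is the set of edges
with both end points in `A`. Every such edge occurs twice, as `(x, y)` and as `(y, x)`, in the
double sum, whence the factor `1 / 2`. -/
noncomputable def energy (G : SimpleGraph V) (p : ℝ) (A : Finset V) (f : V → ℝ) : ℝ :=
  (1 / 2) * ∑ x ∈ A, ∑ y ∈ A, if G.Adj x y then |f x - f y| ^ p else 0

/-- The average `f_B` of `f` over a finite set `B` with respect to the counting measure. -/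
noncomputable def finAvg (B : Finset V) (f : V → ℝ) : ℝ :=
  (∑ y ∈ B, f y) / (B.card : ℝ)

end Graph

/-! ### Sequences of finite graphs

A sequence of graphs indexed by the positive integers is a family `V : ℕ → Type`,
`G n : SimpleGraph (V n)`; all conditions concern the indices `n ≥ 1` only. Likewise only the maps
`proj n k : V n → V k` with `1 ≤ k < n` are ever used. -/

section Sequence

variable {V : ℕ → Type*} [∀ n, Fintype (V n)]

/-- The maps `proj n k`, `1 ≤ k < n`, are surjective and compatible under composition. -/
structure IsProjective (proj : ∀ n k : ℕ, V n → V k) : Prop where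
  surjective : ∀ n k : ℕ, 1 ≤ k → k < n → Function.Surjective (proj n k)
  comp : ∀ l n k : ℕ, 1 ≤ k → k < n → n < l → ∀ v : V l, proj n k (proj l n v) = proj l k v

/-- The sequence of graphs with its projections is `R`-scaled, with constants `A₁`, `A₂`. -/
def IsScaled (G : ∀ n, SimpleGraph (V n)) (proj : ∀ n k : ℕ, V n → V k) (R A₁ A₂ : ℝ) : Prop :=
  ∀ n k : ℕ, 1 ≤ n → 1 ≤ k → ∃ c : V k → V (n + k),
    (∀ w : V k,
      (graphBall (G (n + k)) (c w) (A₁⁻¹ * R ^ n) : Set (V (n + k))) ⊆ proj (n + k) k ⁻¹' {w} ∧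
      proj (n + k) k ⁻¹' {w} ⊆ (graphBall (G (n + k)) (c w) (A₁ * R ^ n) : Set (V (n + k)))) ∧
    ∀ w w' : V k, (G k).dist w w' = 1 → ((G (n + k)).dist (c w) (c w') : ℝ) ≤ A₂ * R ^ n

/-- The sequence of graphs with its projections is `R`-compatible with the metric space `K`,
through the points `pt n v ∈ K` and the Borel sets `cell n v ⊆ K`, with constant `C`. -/
structure IsCompatible {K : Type*} [MetricSpace K] [MeasurableSpace K]
    (G : ∀ n, SimpleGraph (V n)) (proj : ∀ n k : ℕ, V n → V k)
    (pt : ∀ n, V n → K) (cell : ∀ n, V n → Set K) (R C : ℝ) : Prop where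
  measurableSet_cell : ∀ n : ℕ, 1 ≤ n → ∀ v : V n, MeasurableSet (cell n v)
  le_dist : ∀ n : ℕ, 1 ≤ n → ∀ x y : V n,
    C⁻¹ * (((G n).dist x y : ℝ) / R ^ n) ≤ dist (pt n x) (pt n y)
  dist_le : ∀ n : ℕ, 1 ≤ n → ∀ x y : V n,
    dist (pt n x) (pt n y) ≤ C * (((G n).dist x y : ℝ) / R ^ n)
  iUnion_cell : ∀ n : ℕ, 1 ≤ n → ⋃ v : V n, cell n v = Set.univ
  disjoint_cell : ∀ n : ℕ, 1 ≤ n → ∀ u w : V n, u ≠ w → cell n u ∩ cell n w = ∅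
  cell_eq : ∀ n k : ℕ, 1 ≤ k → k < n → ∀ v : V k,
    cell k v = ⋃ w ∈ proj n k ⁻¹' {v}, cell n w
  ball_subset_cell : ∀ n : ℕ, 1 ≤ n → ∀ v : V n,
    Metric.ball (pt n v) (C⁻¹ * (R ^ n)⁻¹) ⊆ cell n v
  cell_subset_ball : ∀ n : ℕ, 1 ≤ n → ∀ v : V n,
    cell n v ⊆ Metric.ball (pt n v) (C * (R ^ n)⁻¹)

/-- The uniform `p`-Poincaré inequality of order `β`, with constants `C` and `A`. -/
def UniformPoincare (G : ∀ n, SimpleGraph (V n)) (p β C A : ℝ) : Prop :=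
  ∀ n : ℕ, 1 ≤ n → ∀ (x : V n) (R : ℝ), 1 ≤ R → ∀ f : V n → ℝ,
    ∑ y ∈ graphBall (G n) x R, |f y - finAvg (graphBall (G n) x R) f| ^ p
      ≤ C * R ^ β * energy (G n) p (graphBall (G n) x (A * R)) f

/-- Uniform existence of `ϑ`-Hölder cut-off functions whose `p`-energy is controlled with
order `β`, with constant `C`. -/
def UniformCutoff (G : ∀ n, SimpleGraph (V n)) (p ϑ β C : ℝ) : Prop :=
  ∀ n : ℕ, 1 ≤ n → ∀ (v : V n) (R : ℝ), 1 ≤ R → ∃ φ : V n → ℝ,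
    (∀ x, φ x ∈ Set.Icc (0 : ℝ) 1) ∧
    (∀ x ∈ graphBall (G n) v R, φ x = 1) ∧
    (Function.support φ ⊆ (graphBall (G n) v (2 * R) : Set (V n))) ∧
    energy (G n) p Finset.univ φ ≤ C * (((graphBall (G n) v R).card : ℝ) / R ^ β) ∧
    ∀ x y, |φ x - φ y| ≤ C * (((G n).dist x y : ℝ) / R) ^ ϑ

end Sequence

/-! ### Function spaces on a metric measure space -/

section Space

variable {K : Type*} [MetricSpace K] [MeasurableSpace K]

/-- `m` is `df`-Ahlfors regular with constant `C`. -/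
def IsAhlforsRegular (m : Measure K) (df C : ℝ) : Prop :=
  ∀ (x : K) (r : ℝ), 0 < r → ENNReal.ofReal r < Metric.ediam (Set.univ : Set K) →
    ENNReal.ofReal (C⁻¹ * r ^ df) ≤ m (Metric.ball x r) ∧
    m (Metric.ball x r) ≤ ENNReal.ofReal (C * r ^ df)

section Sobolev

variable {V : ℕ → Type*} [∀ n, Fintype (V n)]

/-- The normalized energy `R ^ (n (β - df)) * E_p^{G_n}(M_n f)`, where `M_n f v` is the average
of `f` over `cell n v`. -/
noncomputable def normalizedEnergy (m : Measure K) (G : ∀ n, SimpleGraph (V n))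
    (cell : ∀ n, V n → Set K) (p df β R : ℝ) (n : ℕ) (f : K → ℝ) : ℝ :=
  R ^ ((n : ℝ) * (β - df)) *
    energy (G n) p Finset.univ (fun v => ⨍ x in cell n v, f x ∂m)

/-- The Sobolev seminorm `|f|_{F_p} = (sup_{n ≥ 1} E^{(n)}(f)) ^ (1 / p)`, with values
in `[0, ∞]`. -/
noncomputable def sobolevSeminorm (m : Measure K) (G : ∀ n, SimpleGraph (V n))
    (cell : ∀ n, V n → Set K) (p df β R : ℝ) (f : K → ℝ) : ℝ≥0∞ :=
  (⨆ (n : ℕ) (_ : 1 ≤ n), ENNReal.ofReal (normalizedEnergy m G cell p df β R n f)) ^ (1 / p)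

/-- The Sobolev space `F_p`: the `f ∈ L^p` whose normalized energies are bounded. -/
def sobolevSpace (m : Measure K) (G : ∀ n, SimpleGraph (V n))
    (cell : ∀ n, V n → Set K) (p df β R : ℝ) : Set (Lp ℝ (ENNReal.ofReal p) m) :=
  {f | (⨆ (n : ℕ) (_ : 1 ≤ n),
    ENNReal.ofReal (normalizedEnergy m G cell p df β R n f)) < ∞}

end Sobolev

/-- The Korevaar--Schoen energy at scale `r` with scaling exponent `b`, with values in `[0, ∞]`:
`∫_K ⨍_{B(x, r)} |f x - f y| ^ p / r ^ b m(dy) m(dx)`. -/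
noncomputable def ksEnergy (m : Measure K) (p b r : ℝ) (f : K → ℝ) : ℝ≥0∞ :=
  ∫⁻ x, ⨍⁻ y in Metric.ball x r, ENNReal.ofReal (|f x - f y| ^ p / r ^ b) ∂m ∂m

/-- The Besov--Lipschitz space `B^s_{p,∞}`. -/
def besovLipschitz (m : Measure K) (p s : ℝ) : Set (Lp ℝ (ENNReal.ofReal p) m) :=
  {f | (⨆ (r : ℝ) (_ : 0 < r ∧ ENNReal.ofReal r ≤ Metric.ediam (Set.univ : Set K)),
    ksEnergy m p (s * p) r f) < ∞}

/-- The critical exponent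
`s_p = sup {s > 0 | B^s_{p,∞} contains a function that is not (a.e.) constant}`, in `[0, ∞]`. -/
noncomputable def criticalExponent (m : Measure K) (p : ℝ) : ℝ≥0∞ :=
  ⨆ (s : ℝ) (_ : 0 < s ∧ ∃ f ∈ besovLipschitz m p s, ¬ ∃ c : ℝ, ∀ᵐ x ∂m, f x = c),
    ENNReal.ofReal s

end Space

end GraphSobolev

/-! Write `ε_n = R⁻ⁿ`, `e_n` for the normalized energy of the cell averages `M_n f`, and `F(r)` for
the Korevaar–Schoen energy of `f` of order `β` at scale `r`. Everything rests on two inequalities.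

Continuous controls discrete: `e_n ≤ C₁ F(r)` whenever `3κ ε_n ≤ r ≤ 3κR ε_n`. Points in adjacent
cells are at distance at most `2κ ε_n`, so Jensen's inequality on the product of two adjacent cells
bounds each edge term by a piece of the double integral defining `F(r)`
(`IsNet.energy_average_le_ksEnergy`).

Discrete controls continuous: `F(r) ≤ C₂ liminf e_n` for every `r > 0` (`ksEnergy_le_liminf`). For
`ε_n ≤ r`, the Poincaré inequality on graph balls of radius comparable to `r / ε_n` bounds the
energy at scale `r` of the step function `M_n f` by a constant times `e_n`; the powers of `r` cancel
because the order of the Poincaré inequality is `β` (`IsNet.ksEnergy_comp_le`). With `r` fixed, `M_n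
f → f` in `L^p`, and the error disappears as `n → ∞`.

The windows of radii in the first inequality cover all small `r`, so `liminf e_n ≤ C₁ liminf F`, and
chaining gives `e_n ≤ C₁ F(r) ≤ C₁ C₂ liminf e ≤ C₁ C₂ C₁ liminf F`: the energies at all scales are
controlled by those at arbitrarily small ones.

For the critical exponent, a function in a Besov space of order above `β / p` has `F(r) → 0`, hence
`sup F = 0` and it is constant. Conversely, cut-off functions of a fixed macroscopic radius on finer
and finer graphs are almost equicontinuous, and a limit of them is a nonconstant function with
bounded `F` (`exists_nonconstant_ksEnergy_le`).

Uniformity of the constants needs one more argument: Ahlfors regularity is assumed only below the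
diameter, and a lower bound for the diameter in terms of the data comes from volume growth along
geodesics of the graphs (`one_le_mul_diam_rpow`). -/

namespace GraphSobolev

/-! ### Counting and Poincaré estimates on a finite graph -/

section Graph

variable {V : Type*} {G : SimpleGraph V}

theorem dist_triangle_real (hG : G.Connected) (x y z : V) :
    (G.dist x z : ℝ) ≤ G.dist x y + G.dist y z := by
  exact_mod_cast hG.dist_triangle

theorem abs_sub_rpow_le {p : ℝ} (hp : 0 ≤ p) (a b c : ℝ) :
    |a - b| ^ p ≤ 2 ^ p * (|a - c| ^ p + |b - c| ^ p) := by
  have h2 : |a - b| ≤ 2 * max |a - c| |b - c| := by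
    have h1 : |a - b| ≤ |a - c| + |b - c| := by
      rw [abs_sub_comm b c]; exact abs_sub_le a c b
    linarith [le_max_left |a - c| |b - c|, le_max_right |a - c| |b - c|]
  have h3 : (max |a - c| |b - c|) ^ p ≤ |a - c| ^ p + |b - c| ^ p := by
    have h4 : 0 ≤ |a - c| ^ p := by positivity
    have h5 : 0 ≤ |b - c| ^ p := by positivity
    rcases max_choice |a - c| |b - c| with h | h <;> rw [h] <;> linarith
  calc |a - b| ^ p ≤ (2 * max |a - c| |b - c|) ^ p := by gcongr
    _ = 2 ^ p * (max |a - c| |b - c|) ^ p := by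
        rw [Real.mul_rpow (by norm_num) (le_max_of_le_left (abs_nonneg _))]
    _ ≤ _ := by gcongr

theorem sum_sum_abs_sub_rpow_le {p : ℝ} (hp : 0 ≤ p) (B : Finset V) (g : V → ℝ) (c : ℝ) :
    ∑ v ∈ B, ∑ w ∈ B, |g v - g w| ^ p
      ≤ 2 ^ (p + 1) * (B.card : ℝ) * ∑ v ∈ B, |g v - c| ^ p := by
  calc ∑ v ∈ B, ∑ w ∈ B, |g v - g w| ^ p
      ≤ ∑ v ∈ B, ∑ w ∈ B, 2 ^ p * (|g v - c| ^ p + |g w - c| ^ p) := by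
        gcongr with v _ w _; exact abs_sub_rpow_le hp _ _ _
    _ = _ := by
        simp only [← Finset.mul_sum, Finset.sum_add_distrib, Finset.sum_const, nsmul_eq_mul]
        rw [Real.rpow_add (by norm_num), Real.rpow_one]; ring

/-- Cut a shortest walk `j` steps before its end: both pieces bound distances from above, and the
triangle inequality forces equality. -/
theorem exists_dist_eq_of_le (hG : G.Connected) {v w : V} {j : ℕ} (hj : j ≤ G.dist v w) :
    ∃ u, G.dist v u = G.dist v w - j ∧ G.dist u w = j := by
  obtain ⟨q, hq⟩ := hG.exists_walk_length_eq_dist v w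
  refine ⟨q.getVert (G.dist v w - j), ?_⟩
  have h1 : G.dist v (q.getVert (G.dist v w - j)) ≤ G.dist v w - j := by
    refine (SimpleGraph.dist_le (q.take (G.dist v w - j))).trans ?_
    rw [SimpleGraph.Walk.take_length]; omega
  have h2 : G.dist (q.getVert (G.dist v w - j)) w ≤ j := by
    refine (SimpleGraph.dist_le (q.drop (G.dist v w - j))).trans ?_
    rw [SimpleGraph.Walk.drop_length]; omega
  have h3 := hG.dist_triangle (u := v) (v := q.getVert (G.dist v w - j)) (w := w)
  omega

variable [Fintype V]

theorem mem_graphBall {x y : V} {R : ℝ} : y ∈ graphBall G x R ↔ (G.dist x y : ℝ) < R := by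
  simp [graphBall]

theorem mem_graphBall_comm {x y : V} {R : ℝ} : y ∈ graphBall G x R ↔ x ∈ graphBall G y R := by
  rw [mem_graphBall, mem_graphBall, SimpleGraph.dist_comm]

theorem mem_graphBall_self (x : V) {R : ℝ} (hR : 0 < R) : x ∈ graphBall G x R := by
  simpa [mem_graphBall] using hR

theorem graphBall_mono (x : V) {R S : ℝ} (h : R ≤ S) : graphBall G x R ⊆ graphBall G x S :=
  fun _ hy => mem_graphBall.2 ((mem_graphBall.1 hy).trans_le h)

open Classical in
-- Bounded overlap: an ordered edge `(x, y)` is counted only for centres `u` in the ball around `x`,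
-- of which there are at most `b`.
theorem sum_energy_graphBall_le {p r b : ℝ} (hb : ∀ v, ((graphBall G v r).card : ℝ) ≤ b)
    (g : V → ℝ) : ∑ u, energy G p (graphBall G u r) g ≤ b * energy G p Finset.univ g := by
  unfold energy
  rw [← Finset.mul_sum, mul_left_comm]
  refine mul_le_mul_of_nonneg_left ?_ (by norm_num)
  set t : V → V → ℝ := fun x y => if G.Adj x y then |g x - g y| ^ p else 0 with ht
  have ht0 : ∀ x y, 0 ≤ t x y := fun x y => by simp only [ht]; split_ifs <;> positivity
  calc ∑ u, ∑ x ∈ graphBall G u r, ∑ y ∈ graphBall G u r, t x y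
      ≤ ∑ u, ∑ x ∈ graphBall G u r, ∑ y, t x y := by
        refine Finset.sum_le_sum fun u _ => Finset.sum_le_sum fun x _ => ?_
        exact Finset.sum_le_sum_of_subset_of_nonneg (Finset.subset_univ _) fun y _ _ => ht0 x y
    _ = ∑ u, ∑ x, if x ∈ graphBall G u r then ∑ y, t x y else 0 := by
        simp
    _ = ∑ x, ((graphBall G x r).card : ℝ) * ∑ y, t x y := by
        rw [Finset.sum_comm]
        refine Finset.sum_congr rfl fun x _ => ?_
        simp_rw [mem_graphBall_comm (x := _) (y := x)]
        simp
    _ ≤ ∑ x, b * ∑ y, t x y := by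
        refine Finset.sum_le_sum fun x _ => ?_
        exact mul_le_mul_of_nonneg_right (hb x) (Finset.sum_nonneg fun y _ => ht0 x y)
    _ = b * ∑ x, ∑ y, t x y := by rw [Finset.mul_sum]

open Classical in
-- For a pair `v, w` at distance less than `ρ`, average over auxiliary centres `u` in the `ρ`-ball
-- of `v`, of which there are at least `a`. Both points lie in the `2ρ`-ball of `u`, where the
-- Poincaré inequality applies. One factor `b` comes from passing from differences to deviations
-- from the mean, the other from the overlap of the enlarged balls.
theorem sum_graphBall_abs_sub_rpow_le (hG : G.Connected) {p ρ A D a b : ℝ} (hp : 0 ≤ p)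
    (hρ : 0 < ρ) (hA : 1 ≤ A) (hD : 0 ≤ D)
    (hPI : ∀ (x : V) (f : V → ℝ), ∑ y ∈ graphBall G x (2 * ρ),
      |f y - finAvg (graphBall G x (2 * ρ)) f| ^ p ≤ D * energy G p (graphBall G x (A * (2 * ρ))) f)
    (hlow : ∀ v, a ≤ ((graphBall G v ρ).card : ℝ))
    (hup : ∀ v, ((graphBall G v (A * (2 * ρ))).card : ℝ) ≤ b) (g : V → ℝ) :
    a * ∑ v, ∑ w ∈ graphBall G v ρ, |g v - g w| ^ p
      ≤ 2 ^ (p + 1) * b ^ 2 * D * energy G p Finset.univ g := by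
  set t : V → V → ℝ := fun v w => |g v - g w| ^ p
  have ht0 : ∀ v w, 0 ≤ t v w := fun v w => by positivity
  have hb' : ∀ u, ((graphBall G u (2 * ρ)).card : ℝ) ≤ b := fun u => by
    refine le_trans ?_ (hup u)
    exact_mod_cast Finset.card_le_card (graphBall_mono u (by nlinarith))
  have hne : Nonempty V := hG.nonempty
  have hb : 0 ≤ b := le_trans (by positivity) (hb' hne.some)
  calc a * ∑ v, ∑ w ∈ graphBall G v ρ, t v w
      = ∑ v, ∑ w ∈ graphBall G v ρ, a * t v w := by simp [Finset.mul_sum]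
    _ ≤ ∑ v, ∑ w ∈ graphBall G v ρ, ∑ u ∈ graphBall G v ρ, t v w := by
        gcongr with v _ w _
        simp only [Finset.sum_const, nsmul_eq_mul]
        exact mul_le_mul_of_nonneg_right (hlow v) (ht0 v w)
    _ = ∑ u, ∑ v ∈ graphBall G u ρ, ∑ w ∈ graphBall G v ρ, t v w := by
        have hcomm : ∀ v, ∑ w ∈ graphBall G v ρ, ∑ _u ∈ graphBall G v ρ, t v w
            = ∑ _u ∈ graphBall G v ρ, ∑ w ∈ graphBall G v ρ, t v w := fun v => Finset.sum_comm
        rw [Finset.sum_congr rfl fun v _ => hcomm v]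
        calc ∑ v, ∑ u ∈ graphBall G v ρ, ∑ w ∈ graphBall G v ρ, t v w
            = ∑ v, ∑ u, if u ∈ graphBall G v ρ then ∑ w ∈ graphBall G v ρ, t v w else 0 := by simp
          _ = ∑ u, ∑ v, if v ∈ graphBall G u ρ then ∑ w ∈ graphBall G v ρ, t v w else 0 := by
              rw [Finset.sum_comm]
              refine Finset.sum_congr rfl fun u _ => Finset.sum_congr rfl fun v _ => ?_
              simp only [mem_graphBall_comm (x := v) (y := u)]
          _ = _ := by simp
    _ ≤ ∑ u, ∑ v ∈ graphBall G u (2 * ρ), ∑ w ∈ graphBall G u (2 * ρ), t v w := by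
        refine Finset.sum_le_sum fun u _ => ?_
        refine (Finset.sum_le_sum fun v hv => ?_).trans
          (Finset.sum_le_sum_of_subset_of_nonneg (graphBall_mono u (by linarith)) fun v _ _ =>
            Finset.sum_nonneg fun w _ => ht0 v w)
        refine Finset.sum_le_sum_of_subset_of_nonneg (fun w hw => ?_) fun w _ _ => ht0 v w
        rw [mem_graphBall] at hv hw ⊢
        linarith [dist_triangle_real hG u v w]
    _ ≤ ∑ u, 2 ^ (p + 1) * b * (D * energy G p (graphBall G u (A * (2 * ρ))) g) := by
        refine Finset.sum_le_sum fun u _ => ?_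
        refine (sum_sum_abs_sub_rpow_le hp _ g (finAvg (graphBall G u (2 * ρ)) g)).trans ?_
        have h1 := hPI u g
        have h2 : 0 ≤ ∑ y ∈ graphBall G u (2 * ρ),
            |g y - finAvg (graphBall G u (2 * ρ)) g| ^ p := by positivity
        have h3 := hb' u
        gcongr
    _ = 2 ^ (p + 1) * b * D * ∑ u, energy G p (graphBall G u (A * (2 * ρ))) g := by
        rw [Finset.mul_sum]; refine Finset.sum_congr rfl fun u _ => by ring
    _ ≤ 2 ^ (p + 1) * b * D * (b * energy G p Finset.univ g) := by
        gcongr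
        exact sum_energy_graphBall_le hup g
    _ = _ := by ring

/-- Volume growth: enlarging the radius by a quarter of the radius `s` at which the cardinality of
balls is controlled multiplies the cardinality by a bounded factor. -/
theorem card_graphBall_add_mul_le (hG : G.Connected) {s lo up : ℝ} (hs : 4 ≤ s)
    (hlo : ∀ v, lo ≤ ((graphBall G v (s / 4)).card : ℝ))
    (hup : ∀ v, ((graphBall G v s).card : ℝ) ≤ up) (v : V) {r : ℝ} (hr : s ≤ r) :
    ((graphBall G v (r + s / 4)).card : ℝ) * lo ≤ ((graphBall G v r).card : ℝ) * up := by
  classical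
  -- Double counting of pairs `(w, u)` at distance less than `s`, with `w` in the larger ball and
  -- `u` in the smaller one: each `w` has at least `lo` partners, each `u` at most `up`.
  have key := Finset.card_nsmul_le_card_nsmul (R := ℝ) (s := graphBall G v (r + s / 4))
    (t := graphBall G v r) (m := lo) (n := up) (fun w u => u ∈ graphBall G w s)
    (fun w hw => ?_) (fun u hu => ?_)
  · simpa [nsmul_eq_mul] using key
  · have : ∃ u, graphBall G u (s / 4) ⊆
        Finset.bipartiteAbove (fun w u => u ∈ graphBall G w s) (graphBall G v r) w := by
      rw [mem_graphBall] at hw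
      by_cases h : (G.dist v w : ℝ) ≤ s / 2
      · refine ⟨v, fun z hz => ?_⟩
        simp only [Finset.mem_bipartiteAbove, mem_graphBall] at hz ⊢
        have := dist_triangle_real hG w v z
        rw [SimpleGraph.dist_comm (u := w) (v := v)] at this
        constructor <;> linarith
      · push Not at h
        -- Walk back `⌈s / 2⌉` steps from `w` towards `v`. The `s / 4`-ball there stays inside the
        -- `r`-ball of `v`, and inside the `s`-ball of `w` because `s / 2 + 1 + s / 4 ≤ s`, which is
        -- where `4 ≤ s` enters.
        have hj1 : s / 2 ≤ ⌈s / 2⌉₊ := Nat.le_ceil _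
        have hj2 : (⌈s / 2⌉₊ : ℝ) < s / 2 + 1 := Nat.ceil_lt_add_one (by linarith)
        have hj : ⌈s / 2⌉₊ ≤ G.dist v w := Nat.ceil_le.2 h.le
        obtain ⟨u, hu1, hu2⟩ := exists_dist_eq_of_le hG hj
        have hu1' : (G.dist v u : ℝ) = G.dist v w - ⌈s / 2⌉₊ := by
          rw [hu1, Nat.cast_sub hj]
        have hu2' : (G.dist u w : ℝ) = ⌈s / 2⌉₊ := by rw [hu2]
        refine ⟨u, fun z hz => ?_⟩
        simp only [Finset.mem_bipartiteAbove, mem_graphBall] at hz ⊢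
        have h1 := dist_triangle_real hG w u z
        have h2 := dist_triangle_real hG v u z
        rw [SimpleGraph.dist_comm (u := w) (v := u)] at h1
        constructor <;> linarith
    obtain ⟨u, hu⟩ := this
    exact (hlo u).trans (by exact_mod_cast Finset.card_le_card hu)
  · refine le_trans ?_ (hup u)
    exact_mod_cast Finset.card_le_card fun w hw => by
      simp only [Finset.mem_bipartiteBelow] at hw
      exact mem_graphBall_comm.1 hw.2

theorem card_graphBall_le_pow_mul (hG : G.Connected) {s lo up : ℝ} (hs : 4 ≤ s) (hlo0 : 0 < lo)
    (hlo : ∀ v, lo ≤ ((graphBall G v (s / 4)).card : ℝ))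
    (hup : ∀ v, ((graphBall G v s).card : ℝ) ≤ up) (v : V) (j : ℕ) :
    ((graphBall G v (s + j * (s / 4))).card : ℝ) ≤ (up / lo) ^ j * up := by
  have hup0 : 0 ≤ up := le_trans (by positivity) (hup v)
  induction j with
  | zero => simpa using hup v
  | succ j ih =>
    have h := card_graphBall_add_mul_le hG hs hlo hup v (r := s + j * (s / 4))
      (by have : 0 ≤ (j : ℝ) * (s / 4) := by positivity
          linarith)
    have e : s + j * (s / 4) + s / 4 = s + ((j + 1 : ℕ) : ℝ) * (s / 4) := by push_cast; ring
    rw [e, ← le_div_iff₀ hlo0] at h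
    refine h.trans ?_
    rw [pow_succ, mul_div_assoc]
    calc _ ≤ (up / lo) ^ j * up * (up / lo) := by gcongr
      _ = _ := by ring

end Graph

/-! ### One graph as a discretization of the space at a single scale -/

section Level

variable {K V : Type*} [MetricSpace K] [MeasurableSpace K]

/-- A finite graph whose vertices are represented by points and cells of `K` at scale `ε`. -/
structure IsLevel (G : SimpleGraph V) (pt : V → K) (cell : V → Set K) (ε C : ℝ) : Prop where
  measurableSet_cell : ∀ v, MeasurableSet (cell v)
  le_dist : ∀ x y, (G.dist x y : ℝ) * ε ≤ C * dist (pt x) (pt y)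
  dist_le : ∀ x y, dist (pt x) (pt y) ≤ C * (G.dist x y * ε)
  iUnion_cell : ⋃ v, cell v = Set.univ
  disjoint_cell : ∀ u w, u ≠ w → Disjoint (cell u) (cell w)
  ball_subset_cell : ∀ v, Metric.ball (pt v) (ε / C) ⊆ cell v
  cell_subset_ball : ∀ v, cell v ⊆ Metric.ball (pt v) (C * ε)

variable {G : SimpleGraph V} {pt : V → K} {cell : V → Set K} {ε C : ℝ}

theorem IsLevel.exists_mem (h : IsLevel G pt cell ε C) (x : K) : ∃ v, x ∈ cell v := by
  have : x ∈ ⋃ v, cell v := h.iUnion_cell ▸ Set.mem_univ x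
  exact Set.mem_iUnion.1 this

/-- Disjointness of the cells leaves no choice for `i`, so cells can be handled as the fibres of a
map to the vertices. -/
theorem IsLevel.preimage_eq (h : IsLevel G pt cell ε C) {i : K → V} (hi : ∀ x, x ∈ cell (i x))
    (v : V) : i ⁻¹' {v} = cell v := by
  ext x
  refine ⟨fun hx => ?_, fun hx => ?_⟩
  · have : i x = v := hx
    exact this ▸ hi x
  · by_contra hne
    exact Set.disjoint_left.1 (h.disjoint_cell _ _ hne) (hi x) hx

theorem IsCompatible.isLevel {V : ℕ → Type*} [∀ n, Fintype (V n)] {G : ∀ n, SimpleGraph (V n)}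
    {proj : ∀ n k : ℕ, V n → V k} {pt : ∀ n, V n → K} {cell : ∀ n, V n → Set K} {R C : ℝ}
    (hC : 1 ≤ C) (h : IsCompatible G proj pt cell R C) {n : ℕ} (hn : 1 ≤ n) :
    IsLevel (G n) (pt n) (cell n) (R ^ n)⁻¹ C where
  measurableSet_cell := h.measurableSet_cell n hn
  le_dist x y := by
    have := h.le_dist n hn x y
    rwa [inv_mul_le_iff₀ (by linarith), div_eq_mul_inv] at this
  dist_le x y := by simpa only [div_eq_mul_inv] using h.dist_le n hn x y
  iUnion_cell := h.iUnion_cell n hn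
  disjoint_cell u w huw := Set.disjoint_iff_inter_eq_empty.2 (h.disjoint_cell n hn u w huw)
  ball_subset_cell v := by
    rw [div_eq_inv_mul]; exact h.ball_subset_cell n hn v
  cell_subset_ball := h.cell_subset_ball n hn

variable [Fintype V] {m : Measure K} [IsProbabilityMeasure m]

/-- Packing: the cells of the vertices of a graph ball are disjoint and all fit in one ball of the
space. -/
theorem IsLevel.card_mul_le (h : IsLevel G pt cell ε C) (hε : 0 < ε) (hC : 1 ≤ C) {lo ρ : ℝ}
    (hlo : ∀ v, lo ≤ m.real (cell v)) (v : V) :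
    ((graphBall G v ρ).card : ℝ) * lo ≤ m.real (Metric.ball (pt v) (C * ε * (ρ + 1))) := by
  calc ((graphBall G v ρ).card : ℝ) * lo = ∑ w ∈ graphBall G v ρ, lo := by simp
    _ ≤ ∑ w ∈ graphBall G v ρ, m.real (cell w) := Finset.sum_le_sum fun w _ => hlo w
    _ = m.real (⋃ w ∈ graphBall G v ρ, cell w) :=
        (measureReal_biUnion_finset (fun u _ w _ huw => h.disjoint_cell u w huw)
          (fun w _ => h.measurableSet_cell w)).symm
    _ ≤ _ := by
        refine measureReal_mono (Set.iUnion₂_subset fun w hw x hx => ?_)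
        rw [mem_graphBall] at hw
        have h1 := h.cell_subset_ball w hx
        rw [Metric.mem_ball] at h1 ⊢
        have h2 := h.dist_le w v
        rw [SimpleGraph.dist_comm] at h2
        calc dist x (pt v) ≤ dist x (pt w) + dist (pt w) (pt v) := dist_triangle _ _ _
          _ < C * ε + C * (G.dist v w * ε) := by linarith
          _ ≤ C * ε + C * (ρ * ε) := by gcongr
          _ = _ := by ring

/-- Covering: every cell that meets the metric ball belongs to a vertex of the graph ball. -/
theorem IsLevel.measureReal_ball_le (h : IsLevel G pt cell ε C) (hε : 0 < ε) (hC : 1 ≤ C)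
    {up t ρ : ℝ} (hup : ∀ v, m.real (cell v) ≤ up) (hρ : C * (t / ε + C) ≤ ρ) (v : V) :
    m.real (Metric.ball (pt v) t) ≤ ((graphBall G v ρ).card : ℝ) * up := by
  calc m.real (Metric.ball (pt v) t) ≤ m.real (⋃ w ∈ graphBall G v ρ, cell w) := by
        refine measureReal_mono (fun x hx => ?_) (measure_ne_top _ _)
        obtain ⟨w, hw⟩ := h.exists_mem x
        refine Set.mem_iUnion₂.2 ⟨w, ?_, hw⟩
        have h1 := h.cell_subset_ball w hw
        rw [Metric.mem_ball] at h1 hx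
        have h2 := h.le_dist v w
        have h3 : dist (pt v) (pt w) < t + C * ε := by
          have := dist_triangle_left (pt v) (pt w) x
          linarith
        rw [mem_graphBall]
        have h4 : (G.dist v w : ℝ) < C * (t / ε + C) := by
          refine lt_of_mul_lt_mul_right ?_ hε.le
          calc (G.dist v w : ℝ) * ε ≤ C * dist (pt v) (pt w) := h2
            _ < C * (t + C * ε) := by gcongr
            _ = _ := by field_simp
        linarith
    _ ≤ ∑ w ∈ graphBall G v ρ, m.real (cell w) := measureReal_biUnion_finset_le _ _
    _ ≤ ∑ w ∈ graphBall G v ρ, up := Finset.sum_le_sum fun w _ => hup w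
    _ = _ := by simp

/-- Two-sided volume bounds valid at all scales up to that of the whole space. -/
structure AhlforsBounds (m : Measure K) (df κ : ℝ) : Prop where
  one_le : 1 ≤ κ
  upper : ∀ (x : K) (r : ℝ), 0 < r → m.real (Metric.ball x r) ≤ κ * r ^ df
  lower : ∀ (x : K) (r : ℝ), 0 < r → r ≤ 1 → r ^ df ≤ κ * m.real (Metric.ball x r)
  dist_lt : ∀ x y : K, dist x y < κ

/-- A finite graph, together with an index map from the space to its vertices, which is
quasi-isometric to the space at scale `ε`. -/
structure IsNet (m : Measure K) (G : SimpleGraph V) (i : K → V) (df ε κ : ℝ) : Prop where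
  connected : G.Connected
  measurableSet_fiber : ∀ v, MeasurableSet (i ⁻¹' {v})
  dist_le : ∀ x y, dist x y ≤ κ * ε * (G.dist (i x) (i y) + 1)
  le_dist : ∀ x y, (G.dist (i x) (i y) : ℝ) ≤ κ * (dist x y / ε + 1)
  fiber_lower : ∀ v, ε ^ df ≤ κ * m.real (i ⁻¹' {v})
  fiber_upper : ∀ v, m.real (i ⁻¹' {v}) ≤ κ * ε ^ df
  card_le : ∀ v (ρ : ℝ), 1 ≤ ρ → ((graphBall G v ρ).card : ℝ) ≤ κ * ρ ^ df
  le_card : ∀ v (ρ : ℝ), 0 < ρ → ρ * ε ≤ 1 → ρ ^ df ≤ κ * ((graphBall G v ρ).card : ℝ)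

/-- Inscribed and circumscribed balls give each cell a mass comparable to `ε ^ df`; packing and
covering then turn the volume of metric balls into the cardinality of graph balls. -/
theorem IsLevel.isNet (h : IsLevel G pt cell ε C) (hG : G.Connected) (hε : 0 < ε) (hε1 : ε ≤ 1)
    (hC : 1 ≤ C) {df κ : ℝ} (hdf : 1 ≤ df) (hm : AhlforsBounds m df κ) {i : K → V}
    (hi : ∀ x, x ∈ cell (i x)) : IsNet m G i df ε (κ ^ 2 * (2 * C ^ 2) ^ df) := by
  have hκ := hm.one_le
  have hC0 : 0 < C := by linarith
  have hdf0 : 0 ≤ df := by linarith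
  set κ' := κ ^ 2 * (2 * C ^ 2) ^ df with hκ'
  have hC2 : 1 ≤ C ^ 2 := by nlinarith
  have hCC2 : C ≤ C ^ 2 := by nlinarith
  have hκ2 : 1 ≤ κ ^ 2 := by nlinarith
  have hκκ2 : κ ≤ κ ^ 2 := by nlinarith
  have h2C : 2 * C ^ 2 ≤ (2 * C ^ 2) ^ df := by
    conv_lhs => rw [← Real.rpow_one (2 * C ^ 2)]
    exact Real.rpow_le_rpow_of_exponent_le (by linarith) hdf
  have hle : (2 * C ^ 2) ^ df ≤ κ' := le_mul_of_one_le_left (by positivity) hκ2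
  have hfib := h.preimage_eq hi
  have hup : ∀ v, m.real (cell v) ≤ κ * (C * ε) ^ df := fun v =>
    (measureReal_mono (h.cell_subset_ball v)).trans (hm.upper _ _ (by positivity))
  have hlo : ∀ v, (ε / C) ^ df / κ ≤ m.real (cell v) := fun v => by
    rw [div_le_iff₀' (by linarith)]
    refine (hm.lower (pt v) (ε / C) (by positivity)
      (by rw [div_le_one hC0]; linarith)).trans ?_
    gcongr
    exacts [measure_ne_top _ _, h.ball_subset_cell v]
  refine ⟨hG, fun v => hfib v ▸ h.measurableSet_cell v, fun x y => ?_, fun x y => ?_, fun v => ?_,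
    fun v => ?_, fun v ρ hρ => ?_, fun v ρ hρ hρε => ?_⟩
  · have h1 := Metric.mem_ball.1 (h.cell_subset_ball _ (hi x))
    have h2 := Metric.mem_ball.1 (h.cell_subset_ball _ (hi y))
    have h3 := h.dist_le (i x) (i y)
    have h4 := dist_triangle4_right x y (pt (i x)) (pt (i y))
    have h5 : 2 * C ≤ κ' := by linarith
    have h6 : (0 : ℝ) ≤ G.dist (i x) (i y) := by positivity
    calc dist x y ≤ 2 * C * ε * (G.dist (i x) (i y) + 1) := by
          have h7 : 0 ≤ C * (G.dist (i x) (i y) * ε) := by positivity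
          nlinarith
      _ ≤ _ := by gcongr
  · have h1 := Metric.mem_ball.1 (h.cell_subset_ball _ (hi x))
    have h2 := Metric.mem_ball.1 (h.cell_subset_ball _ (hi y))
    have h3 := h.le_dist (i x) (i y)
    have h4 : dist (pt (i x)) (pt (i y)) ≤ dist x y + 2 * C * ε := by
      have := dist_triangle4 (pt (i x)) x y (pt (i y))
      rw [dist_comm _ x] at this
      linarith
    have h5 : (G.dist (i x) (i y) : ℝ) ≤ 2 * C ^ 2 * (dist x y / ε + 1) := by
      refine le_of_mul_le_mul_right ?_ hε
      calc (G.dist (i x) (i y) : ℝ) * ε ≤ C * (dist x y + 2 * C * ε) := by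
            refine h3.trans (by gcongr)
        _ = C * dist x y + 2 * C ^ 2 * ε := by ring
        _ ≤ 2 * C ^ 2 * dist x y + 2 * C ^ 2 * ε := by
            gcongr; linarith
        _ = _ := by field_simp
    refine h5.trans ?_
    gcongr; linarith
  · rw [hfib]
    have h1 := hlo v
    rw [div_le_iff₀' (by linarith), Real.div_rpow hε.le hC0.le, div_le_iff₀ (by positivity)] at h1
    refine h1.trans ?_
    have : κ * C ^ df ≤ κ' := by
      rw [hκ']; gcongr; linarith
    calc κ * m.real (cell v) * C ^ df = κ * C ^ df * m.real (cell v) := by ring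
      _ ≤ _ := by gcongr
  · rw [hfib]
    refine (hup v).trans ?_
    rw [Real.mul_rpow hC0.le hε.le, ← mul_assoc, hκ']
    gcongr; linarith
  · have h1 := h.card_mul_le hε hC hlo v (ρ := ρ)
    have h2 : m.real (Metric.ball (pt v) (C * ε * (ρ + 1))) ≤ κ * (C * ε * (2 * ρ)) ^ df :=
      (hm.upper _ _ (by positivity)).trans (by gcongr; linarith)
    have h3 := h1.trans h2
    have e1 : (ε / C) ^ df / κ = ε ^ df / (C ^ df * κ) := by
      rw [Real.div_rpow hε.le hC0.le, div_div]
    have e2 : (C * ε * (2 * ρ)) ^ df = C ^ df * ε ^ df * (2 ^ df * ρ ^ df) := by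
      rw [Real.mul_rpow (by positivity) (by positivity), Real.mul_rpow hC0.le hε.le,
        Real.mul_rpow (by norm_num) (by linarith)]
    have e3 : (2 * C ^ 2) ^ df = 2 ^ df * (C ^ df * C ^ df) := by
      rw [Real.mul_rpow (by norm_num) (by positivity), pow_two, Real.mul_rpow hC0.le hC0.le]
    rw [e1, e2] at h3
    have hεp : 0 < ε ^ df := by positivity
    have hCp : 0 < C ^ df := by positivity
    rw [hκ', e3, ← mul_le_mul_iff_left₀ (show 0 < ε ^ df / (C ^ df * κ) by positivity)]
    refine h3.trans (le_of_eq ?_)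
    field_simp
  · have hcard : (1 : ℝ) ≤ (graphBall G v ρ).card := by
      exact_mod_cast Finset.card_pos.2 ⟨v, mem_graphBall_self v hρ⟩
    -- For small `ρ` the centre alone is enough. For large `ρ`, cover the ball of radius `ε ρ /
    -- (2C)`: the graph radius required is `ρ / 2 + C ^ 2 ≤ ρ`.
    rcases le_total ρ (2 * C ^ 2) with hρC | hρC
    · calc ρ ^ df ≤ (2 * C ^ 2) ^ df := by gcongr
        _ ≤ κ' := hle
        _ ≤ _ := le_mul_of_one_le_right (by positivity) hcard
    · have h1 := h.measureReal_ball_le hε hC hup (t := ε * ρ / (2 * C)) (ρ := ρ) (by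
        have : C * (ε * ρ / (2 * C) / ε + C) = ρ / 2 + C ^ 2 := by field_simp
        rw [this]; linarith) v
      have h2 := hm.lower (pt v) (ε * ρ / (2 * C)) (by positivity)
        (by rw [div_le_one (by positivity)]; nlinarith)
      have h3 : (ε * ρ / (2 * C)) ^ df ≤ κ * ((graphBall G v ρ).card * (κ * (C * ε) ^ df)) :=
        h2.trans (by gcongr)
      have e1 : (ε * ρ / (2 * C)) ^ df = ε ^ df * ρ ^ df / (2 * C) ^ df := by
        rw [Real.div_rpow (by positivity) (by positivity), Real.mul_rpow hε.le hρ.le]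
      have e2 : (2 * C ^ 2) ^ df = (2 * C) ^ df * C ^ df := by
        rw [← Real.mul_rpow (by positivity) (by positivity)]; ring_nf
      rw [e1, Real.mul_rpow hC0.le hε.le, div_le_iff₀ (by positivity)] at h3
      have hεp : 0 < ε ^ df := by positivity
      rw [← mul_le_mul_iff_right₀ hεp]
      refine h3.trans (le_of_eq ?_)
      rw [hκ', e2]; ring

end Level

/-! ### Volume bounds independent of the diameter -/

section Diameter

variable {K : Type*} [MetricSpace K] [CompactSpace K] [MeasurableSpace K] {m : Measure K}
  [IsProbabilityMeasure m]

theorem IsAhlforsRegular.real_bounds {df A : ℝ} (h : IsAhlforsRegular m df A) (hA : 1 ≤ A) (x : K)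
    {r : ℝ} (hr : 0 < r) (hrD : r < Metric.diam (Set.univ : Set K)) :
    r ^ df ≤ A * m.real (Metric.ball x r) ∧ m.real (Metric.ball x r) ≤ A * r ^ df := by
  have hfin : Metric.ediam (Set.univ : Set K) ≠ ⊤ := isCompact_univ.isBounded.ediam_ne_top
  obtain ⟨h1, h2⟩ := h x r hr ((ENNReal.ofReal_lt_iff_lt_toReal hr.le hfin).2 hrD)
  constructor
  · rw [← inv_mul_le_iff₀ (by linarith)]
    exact (ENNReal.ofReal_le_iff_le_toReal (measure_ne_top _ _)).1 h1
  · exact ENNReal.toReal_le_of_le_ofReal (by positivity) h2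

/-- A volume bound from which the diameter is bounded from below: the graph metric being geodesic,
the whole space is reached from a ball of radius comparable to its diameter in boundedly many
steps, each multiplying the volume by a bounded factor. -/
theorem one_le_mul_diam_rpow {V : Type*} [Fintype V] {G : SimpleGraph V} {pt : V → K}
    {cell : V → Set K} {ε C df A : ℝ} (h : IsLevel G pt cell ε C) (hG : G.Connected) (hε : 0 < ε)
    (hC : 1 ≤ C) (hdf : 1 ≤ df) (hA : 1 ≤ A) (hm : IsAhlforsRegular m df A)
    (hεD : (8 * C ^ 2 + 5) * (2 * C * ε) ≤ Metric.diam (Set.univ : Set K)) :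
    1 ≤ (A ^ 4 * (16 * C ^ 4) ^ df) ^ ⌈16 * C ^ 2⌉₊ * A ^ 3 *
      (C ^ 2 * Metric.diam (Set.univ : Set K)) ^ df := by
  set D := Metric.diam (Set.univ : Set K) with hD
  -- With this `s`, the cells of a graph ball of radius `s` lie in a metric ball of radius `C ε (s +
  -- 1) = D / 2`, where Ahlfors regularity is available.
  set s := D / (2 * C * ε) - 1 with hs
  have hC0 : 0 < C := by linarith
  have hA0 : 0 < A := by linarith
  have hdf0 : 0 ≤ df := by linarith
  have hC2 : 1 ≤ C ^ 2 := by nlinarith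
  have hsD : 2 * C * ε * (s + 1) = D := by rw [hs]; field_simp; ring
  have hs8 : 8 * C ^ 2 + 4 ≤ s := by
    rw [hs, le_sub_iff_add_le, le_div_iff₀ (by positivity)]
    linarith
  have hs0 : 0 < s := by linarith
  have hCε : C * ε < D := by
    rw [← hsD]; nlinarith [mul_pos hC0 hε]
  have hεC : ε / C < D := lt_of_le_of_lt
    ((div_le_self hε.le hC).trans (le_mul_of_one_le_left hε.le hC)) hCε
  have hup : ∀ v, m.real (cell v) ≤ A * (C * ε) ^ df := fun v =>
    (measureReal_mono (h.cell_subset_ball v)).trans (hm.real_bounds hA _ (by positivity) hCε).2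
  have hlo : ∀ v, (ε / C) ^ df / A ≤ m.real (cell v) := fun v => by
    rw [div_le_iff₀' hA0]
    refine (hm.real_bounds hA (pt v) (by positivity) hεC).1.trans ?_
    gcongr
    exacts [measure_ne_top _ _, h.ball_subset_cell v]
  have hcup : ∀ v, ((graphBall G v s).card : ℝ) ≤ A ^ 2 * (2 * C ^ 2 * s) ^ df := fun v => by
    have h1 := h.card_mul_le hε hC hlo v (ρ := s)
    have h2 : m.real (Metric.ball (pt v) (C * ε * (s + 1))) ≤ A * (C * ε * (2 * s)) ^ df :=
      (hm.real_bounds hA (pt v) (by positivity) (by nlinarith [mul_pos hC0 hε])).2.trans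
        (by gcongr; linarith)
    have h3 := h1.trans h2
    have e1 : C * ε * (2 * s) = (2 * C ^ 2 * s) * (ε / C) := by field_simp
    rw [e1, Real.mul_rpow (by positivity) (by positivity)] at h3
    have hp : 0 < (ε / C) ^ df := by positivity
    rw [← mul_le_mul_iff_left₀ (show 0 < (ε / C) ^ df / A by positivity)]
    refine h3.trans (le_of_eq ?_)
    field_simp
  have hclo : ∀ v, (s / (8 * C ^ 2)) ^ df / A ^ 2 ≤ ((graphBall G v (s / 4)).card : ℝ) :=
    fun v => by
    have h1 := h.measureReal_ball_le hε hC hup (t := ε * s / (8 * C)) (ρ := s / 4) (by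
      have : C * (ε * s / (8 * C) / ε + C) = s / 8 + C ^ 2 := by field_simp
      rw [this]; linarith) v
    have h2 := (hm.real_bounds hA (pt v) (r := ε * s / (8 * C)) (by positivity) (by
      rw [div_lt_iff₀ (by positivity), ← hD, ← hsD]
      have : 0 < ε * s := by positivity
      have h4 : 0 < C * ε * s := by positivity
      nlinarith)).1
    have h3 : (ε * s / (8 * C)) ^ df ≤ A * ((graphBall G v (s / 4)).card * (A * (C * ε) ^ df)) :=
      h2.trans (by gcongr)
    have e1 : ε * s / (8 * C) = s / (8 * C ^ 2) * (C * ε) := by field_simp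
    rw [e1, Real.mul_rpow (by positivity) (by positivity)] at h3
    have hp : 0 < (C * ε) ^ df := by positivity
    rw [div_le_iff₀ (by positivity), ← mul_le_mul_iff_left₀ hp]
    refine h3.trans (le_of_eq ?_)
    ring
  have hne : Nonempty V := hG.nonempty
  obtain ⟨v⟩ := hne
  -- The graph has diameter at most `2C²(s + 1) < s + 4C² s`, so starting from radius `s`, `⌈16C²⌉`
  -- increments of `s / 4` exhaust it.
  have hgrow := card_graphBall_le_pow_mul hG (by linarith) (by positivity) hclo hcup v
    ⌈16 * C ^ 2⌉₊
  have hall : graphBall G v (s + ⌈16 * C ^ 2⌉₊ * (s / 4)) = Finset.univ := by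
    ext w
    simp only [mem_graphBall, Finset.mem_univ, iff_true]
    have h1 := h.le_dist v w
    have h2 : dist (pt v) (pt w) ≤ D :=
      Metric.dist_le_diam_of_mem isCompact_univ.isBounded (Set.mem_univ _) (Set.mem_univ _)
    have h3 : (G.dist v w : ℝ) ≤ 2 * C ^ 2 * (s + 1) := by
      refine le_of_mul_le_mul_right ?_ hε
      calc (G.dist v w : ℝ) * ε ≤ C * D := h1.trans (by gcongr)
        _ = _ := by rw [← hsD]; ring
    have h4 : 16 * C ^ 2 * (s / 4) ≤ ⌈16 * C ^ 2⌉₊ * (s / 4) := by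
      gcongr; exact Nat.le_ceil _
    nlinarith
  rw [hall] at hgrow
  -- The radius `s` cancels in the growth factor, so the constant depends on `A`, `C`, `df` only.
  have hratio : A ^ 2 * (2 * C ^ 2 * s) ^ df / ((s / (8 * C ^ 2)) ^ df / A ^ 2)
      = A ^ 4 * (16 * C ^ 4) ^ df := by
    have e1 : 2 * C ^ 2 * s = 16 * C ^ 4 * (s / (8 * C ^ 2)) := by field_simp; ring
    rw [e1, Real.mul_rpow (by positivity) (by positivity)]
    have hp : 0 < (s / (8 * C ^ 2)) ^ df := by positivity
    field_simp
  rw [hratio] at hgrow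
  -- The total mass is `1`, so the cardinality of the graph is at least the inverse of the bound for
  -- the mass of a cell.
  have hone : 1 ≤ ((Finset.univ : Finset V).card : ℝ) * (A * (C * ε) ^ df) := by
    calc (1 : ℝ) = m.real (⋃ v ∈ (Finset.univ : Finset V), cell v) := by
          simp [h.iUnion_cell]
      _ ≤ ∑ v, m.real (cell v) := measureReal_biUnion_finset_le _ _
      _ ≤ ∑ _v : V, A * (C * ε) ^ df := Finset.sum_le_sum fun v _ => hup v
      _ = _ := by simp
  calc (1 : ℝ) ≤ (A ^ 4 * (16 * C ^ 4) ^ df) ^ ⌈16 * C ^ 2⌉₊ * (A ^ 2 * (2 * C ^ 2 * s) ^ df) *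
        (A * (C * ε) ^ df) := hone.trans (by gcongr)
    _ = (A ^ 4 * (16 * C ^ 4) ^ df) ^ ⌈16 * C ^ 2⌉₊ * A ^ 3 *
        ((2 * C ^ 2 * s) * (C * ε)) ^ df := by
        rw [Real.mul_rpow (x := 2 * C ^ 2 * s) (y := C * ε) (by positivity) (by positivity)]; ring
    _ ≤ _ := by
        have h3 : 2 * C ^ 2 * s * (C * ε) ≤ C ^ 2 * D := by
          rw [← hsD]
          have : 0 < C ^ 3 * ε := by positivity
          nlinarith
        exact mul_le_mul_of_nonneg_left (Real.rpow_le_rpow (by positivity) h3 hdf0)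
          (by positivity)

/-- Only radii at or above the diameter `D` need an argument. There the mass is at most `1 ≤ Q D ^
df`, which gives the upper bound; for the lower one, balls of radius greater than `D` are the whole
space, and `r ≤ 1`. Finally `D ≤ A`, since `r ^ df ≤ A` for all `r < D` and `1 ≤ df`. -/
theorem IsAhlforsRegular.ahlforsBounds [Nontrivial K] {df A Q : ℝ} (hdf : 1 ≤ df) (hA : 1 ≤ A)
    (hQ : 0 ≤ Q) (hm : IsAhlforsRegular m df A)
    (hdiam : 1 ≤ Q * Metric.diam (Set.univ : Set K) ^ df) :
    AhlforsBounds m df (A * 2 ^ df + Q + 1) := by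
  set D := Metric.diam (Set.univ : Set K) with hD
  have hdf0 : 0 ≤ df := by linarith
  have hD0 : 0 < D := Metric.diam_pos Set.nontrivial_univ isCompact_univ.isBounded
  have h2 : 1 ≤ (2 : ℝ) ^ df := Real.one_le_rpow (by norm_num) hdf0
  have hA2 : A ≤ A * 2 ^ df := le_mul_of_one_le_right (by linarith) h2
  have hdistD : ∀ x y : K, dist x y ≤ D := fun x y =>
    Metric.dist_le_diam_of_mem isCompact_univ.isBounded (Set.mem_univ _) (Set.mem_univ _)
  have hball : ∀ (x : K) (r : ℝ), D < r → m.real (Metric.ball x r) = 1 := fun x r hr => by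
    have : Metric.ball x r = Set.univ := Set.eq_univ_of_forall fun y =>
      (hdistD y x).trans_lt hr
    rw [this]; simp
  have hDA : D ≤ A := by
    refine le_of_forall_lt_imp_le_of_dense fun r hr => ?_
    rcases le_total r 1 with h1 | h1
    · linarith
    · obtain ⟨x⟩ : Nonempty K := inferInstance
      have h3 := (hm.real_bounds hA x (by linarith) hr).1
      calc r = r ^ (1 : ℝ) := (Real.rpow_one r).symm
        _ ≤ r ^ df := Real.rpow_le_rpow_of_exponent_le h1 hdf
        _ ≤ A * 1 := h3.trans (by gcongr; exact measureReal_le_one)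
        _ = A := mul_one A
  refine ⟨by linarith, fun x r hr => ?_, fun x r hr hr1 => ?_, fun x y => ?_⟩
  · rcases lt_or_ge r D with hrD | hrD
    · refine (hm.real_bounds hA x hr hrD).2.trans ?_
      gcongr; linarith
    · calc m.real (Metric.ball x r) ≤ 1 := measureReal_le_one
        _ ≤ Q * D ^ df := hdiam
        _ ≤ _ := by gcongr; linarith
  · have key : r ^ df ≤ A * 2 ^ df * m.real (Metric.ball x r) := by
      rcases lt_trichotomy r D with hrD | hrD | hrD
      · refine (hm.real_bounds hA x hr hrD).1.trans ?_
        gcongr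
      · have h3 := (hm.real_bounds hA x (r := r / 2) (by linarith) (by linarith)).1
        rw [Real.div_rpow hr.le (by norm_num), div_le_iff₀ (by positivity)] at h3
        calc r ^ df ≤ A * m.real (Metric.ball x (r / 2)) * 2 ^ df := h3
          _ = A * 2 ^ df * m.real (Metric.ball x (r / 2)) := by ring
          _ ≤ _ := by
              gcongr
              · exact measure_ne_top _ _
              · linarith
      · rw [hball x r hrD, mul_one]
        have := Real.rpow_le_one hr.le hr1 hdf0
        linarith
    refine key.trans ?_
    gcongr; linarith
  · linarith [hdistD x y]

end Diameter

/-- The volume bounds hold with a constant depending only on the data: Ahlfors regularity alone,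
being imposed below the diameter only, does not give this. -/
theorem exists_ahlforsBounds {df R A C : ℝ} (hdf : 1 ≤ df) (hR : 1 < R) (hA : 1 ≤ A)
    (hC : 1 ≤ C) : ∃ κ : ℝ, 1 ≤ κ ∧
      ∀ (K : Type*) [MetricSpace K] [CompactSpace K] [Nontrivial K] [MeasurableSpace K]
        (m : Measure K) [IsProbabilityMeasure m] (V : ℕ → Type*) [∀ n, Fintype (V n)]
        (G : ∀ n, SimpleGraph (V n)) (proj : ∀ n k : ℕ, V n → V k) (pt : ∀ n, V n → K)
        (cell : ∀ n, V n → Set K), IsAhlforsRegular m df A →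
        (∀ n : ℕ, 1 ≤ n → (G n).Connected) → IsCompatible G proj pt cell R C →
        AhlforsBounds m df κ := by
  set Q := (A ^ 4 * (16 * C ^ 4) ^ df) ^ ⌈16 * C ^ 2⌉₊ * A ^ 3 * (C ^ 2) ^ df
  have hQ : 0 ≤ Q := by positivity
  refine ⟨A * 2 ^ df + Q + 1, ?_, ?_⟩
  · have : 0 ≤ A * 2 ^ df := by positivity
    linarith
  intro K _ _ _ _ m _ V _ G proj pt cell hm hG hc
  refine hm.ahlforsBounds hdf hA hQ ?_
  set D := Metric.diam (Set.univ : Set K) with hD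
  have hD0 : 0 < D := Metric.diam_pos Set.nontrivial_univ isCompact_univ.isBounded
  have hC0 : 0 < C := by linarith
  have ht : Tendsto (fun n : ℕ => (8 * C ^ 2 + 5) * (2 * C * (R ^ n)⁻¹)) atTop
      (𝓝 ((8 * C ^ 2 + 5) * (2 * C * 0))) :=
    ((tendsto_inv_atTop_zero.comp (tendsto_pow_atTop_atTop_of_one_lt hR)).const_mul _).const_mul _
  simp only [mul_zero] at ht
  -- Any level fine enough relative to the diameter will do, since the resulting bound does not
  -- involve `n`.
  obtain ⟨n, hn1, hn⟩ := ((ht.eventually (ge_mem_nhds hD0)).and (eventually_ge_atTop 1)).exists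
  have := one_le_mul_diam_rpow (hc.isLevel hC hn) (hG n hn) (by positivity) hC hdf hA hm hn1
  rwa [Real.mul_rpow (by positivity) hD0.le, ← mul_assoc] at this

/-! ### Elementary inequalities and Jensen's inequality -/

theorem ofReal_abs_add_rpow_le {p : ℝ} (hp : 0 ≤ p) (a b : ℝ) :
    ENNReal.ofReal (|a + b| ^ p)
      ≤ ENNReal.ofReal (2 ^ p) * (ENNReal.ofReal (|a| ^ p) + ENNReal.ofReal (|b| ^ p)) := by
  rw [← ENNReal.ofReal_add (by positivity) (by positivity), ← ENNReal.ofReal_mul (by positivity)]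
  refine ENNReal.ofReal_le_ofReal ?_
  simpa using abs_sub_rpow_le hp a (-b) 0

theorem ofReal_abs_rpow {p : ℝ} (hp : 0 ≤ p) (a : ℝ) :
    ENNReal.ofReal (|a| ^ p) = ‖a‖ₑ ^ p := by
  rw [Real.enorm_eq_ofReal_abs, ENNReal.ofReal_rpow_of_nonneg (abs_nonneg _) hp]

section Jensen

variable {X : Type*} [MeasurableSpace X] {m : Measure X}

/-- Jensen's inequality for the average over a set. -/
theorem ofReal_abs_setAverage_sub_rpow_mul_le {p : ℝ} (hp : 1 ≤ p) {s : Set X} (hs : m s ≠ ⊤)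
    {f : X → ℝ} (hf : IntegrableOn f s m) (c : ℝ) :
    ENNReal.ofReal (|(⨍ x in s, f x ∂m) - c| ^ p) * m s
      ≤ ∫⁻ x in s, ENNReal.ofReal (|f x - c| ^ p) ∂m := by
  rcases eq_or_ne (m s) 0 with h0 | h0
  · simp [h0]
  have hp0 : 0 < p := by linarith
  set ν : Measure X := (m s)⁻¹ • m.restrict s with hν
  have hprob : IsProbabilityMeasure ν := ⟨by
    rw [hν, Measure.smul_apply, Measure.restrict_apply_univ, smul_eq_mul,
      ENNReal.inv_mul_cancel h0 hs]⟩
  have hfν : Integrable f ν := hf.integrable.smul_measure (by simpa using h0)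
  have e1 : (⨍ x in s, f x ∂m) - c = ∫ x, (f x - c) ∂ν := by
    rw [integral_sub hfν (integrable_const c), setAverage_eq']
    simp [hν]
  have h1 : ‖∫ x, (f x - c) ∂ν‖ₑ ≤ (∫⁻ x, ‖f x - c‖ₑ ^ p ∂ν) ^ (1 / p) := by
    have h2 := eLpNorm'_le_eLpNorm'_of_exponent_le (μ := ν) (f := fun x => f x - c) one_pos hp
      (hfν.1.sub aestronglyMeasurable_const)
    rw [eLpNorm'_eq_lintegral_enorm, eLpNorm'_eq_lintegral_enorm] at h2
    simp only [ENNReal.rpow_one, div_one] at h2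
    exact (enorm_integral_le_lintegral_enorm _).trans h2
  have h3 : ENNReal.ofReal (|(⨍ x in s, f x ∂m) - c| ^ p) ≤ ∫⁻ x, ‖f x - c‖ₑ ^ p ∂ν := by
    rw [ofReal_abs_rpow hp0.le, e1]
    calc _ ≤ ((∫⁻ x, ‖f x - c‖ₑ ^ p ∂ν) ^ (1 / p)) ^ p := ENNReal.rpow_le_rpow h1 hp0.le
      _ = _ := by rw [← ENNReal.rpow_mul, one_div_mul_cancel hp0.ne', ENNReal.rpow_one]
  simp_rw [ofReal_abs_rpow hp0.le] at h3 ⊢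
  rw [hν, lintegral_smul_measure, smul_eq_mul] at h3
  calc _ ≤ ((m s)⁻¹ * ∫⁻ x in s, ‖f x - c‖ₑ ^ p ∂m) * m s := by gcongr
    _ = _ := by rw [mul_comm, ← mul_assoc, ENNReal.mul_inv_cancel h0 hs, one_mul]

end Jensen

/-! ### Korevaar–Schoen energies and double integrals -/

section KS

variable {K : Type*} [MetricSpace K] [MeasurableSpace K]

/-- The double integral of `|f x - f y| ^ p` over the pairs of points at distance less than `r`. -/
noncomputable def ksIntegral (m : Measure K) (p r : ℝ) (f : K → ℝ) : ℝ≥0∞ :=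
  ∫⁻ x, ∫⁻ y in Metric.ball x r, ENNReal.ofReal (|f x - f y| ^ p) ∂m ∂m

variable {m : Measure K} {p b r : ℝ} {f : K → ℝ}

theorem laverage_ball_eq (hr : 0 < r) (x : K) :
    (⨍⁻ y in Metric.ball x r, ENNReal.ofReal (|f x - f y| ^ p / r ^ b) ∂m)
      = (∫⁻ y in Metric.ball x r, ENNReal.ofReal (|f x - f y| ^ p) ∂m)
        * ((ENNReal.ofReal (r ^ b))⁻¹ * (m (Metric.ball x r))⁻¹) := by
  have hrb : 0 < r ^ b := by positivity
  rw [setLAverage_eq, ENNReal.div_eq_inv_mul]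
  simp_rw [ENNReal.ofReal_div_of_pos hrb, div_eq_mul_inv]
  rw [lintegral_mul_const' _ _ (by simpa using hrb)]
  ring

theorem ksEnergy_congr_ae {f g : K → ℝ} (h : f =ᵐ[m] g) :
    ksEnergy m p b r f = ksEnergy m p b r g := by
  unfold ksEnergy
  refine lintegral_congr_ae ?_
  filter_upwards [h] with x hx
  rw [setLAverage_eq, setLAverage_eq]
  congr 1
  refine lintegral_congr_ae ?_
  filter_upwards [ae_restrict_of_ae h] with y hy
  rw [hx, hy]

/-- Once balls are the whole space, the average no longer depends on the radius and the weight `r ^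
(-b)` decreases. This reduces the supremum over all radii to bounded ones. -/
theorem ksEnergy_le_of_univ {r₀ : ℝ} (hr₀ : 0 < r₀) (hb : 0 ≤ b) (hrr : r₀ ≤ r)
    (hd : ∀ x y : K, dist x y < r₀) : ksEnergy m p b r f ≤ ksEnergy m p b r₀ f := by
  unfold ksEnergy
  refine lintegral_mono fun x => ?_
  have h1 : Metric.ball x r₀ = Set.univ := Set.eq_univ_of_forall fun y => hd y x
  have h2 : Metric.ball x r = Set.univ := Set.eq_univ_of_forall fun y => (hd y x).trans_le hrr
  rw [h1, h2, setLAverage_eq, setLAverage_eq]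
  gcongr

variable [IsProbabilityMeasure m]

theorem ksEnergy_le_ksIntegral {c : ℝ} (hr : 0 < r) (hc : 0 < c)
    (h : ∀ x, c ≤ m.real (Metric.ball x r)) :
    ksEnergy m p b r f ≤ ENNReal.ofReal ((c * r ^ b)⁻¹) * ksIntegral m p r f := by
  have hrb : 0 < r ^ b := by positivity
  unfold ksEnergy ksIntegral
  rw [← lintegral_const_mul' _ _ ENNReal.ofReal_ne_top]
  refine lintegral_mono fun x => ?_
  rw [laverage_ball_eq hr, mul_comm]
  gcongr
  rw [mul_inv, mul_comm, ENNReal.ofReal_mul (by positivity), ENNReal.ofReal_inv_of_pos hc,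
    ENNReal.ofReal_inv_of_pos hrb]
  gcongr
  exact (ENNReal.ofReal_le_iff_le_toReal (measure_ne_top _ _)).2 (h x)

theorem ksIntegral_le_ksEnergy {c : ℝ} (hr : 0 < r) (hc : 0 ≤ c)
    (h0 : ∀ x, 0 < m.real (Metric.ball x r)) (h : ∀ x, m.real (Metric.ball x r) ≤ c) :
    ksIntegral m p r f ≤ ENNReal.ofReal (c * r ^ b) * ksEnergy m p b r f := by
  have hrb : 0 < r ^ b := by positivity
  unfold ksEnergy ksIntegral
  rw [← lintegral_const_mul' _ _ ENNReal.ofReal_ne_top]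
  refine lintegral_mono fun x => ?_
  have hm : m (Metric.ball x r) ≤ ENNReal.ofReal c :=
    (ENNReal.le_ofReal_iff_toReal_le (measure_ne_top _ _) hc).2 (h x)
  have hm0 : m (Metric.ball x r) ≠ 0 := fun h1 => (h0 x).ne' (by simp [Measure.real, h1])
  set I := ∫⁻ y in Metric.ball x r, ENNReal.ofReal (|f x - f y| ^ p) ∂m
  have e : m (Metric.ball x r) * ENNReal.ofReal (r ^ b) *
      ((ENNReal.ofReal (r ^ b))⁻¹ * (m (Metric.ball x r))⁻¹) = 1 := by
    rw [mul_assoc, ← mul_assoc (ENNReal.ofReal (r ^ b)),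
      ENNReal.mul_inv_cancel (by simpa using hrb) ENNReal.ofReal_ne_top, one_mul,
      ENNReal.mul_inv_cancel hm0 (measure_ne_top _ _)]
  rw [laverage_ball_eq hr, ENNReal.ofReal_mul hc]
  calc I = I * (m (Metric.ball x r) * ENNReal.ofReal (r ^ b) *
      ((ENNReal.ofReal (r ^ b))⁻¹ * (m (Metric.ball x r))⁻¹)) := by rw [e, mul_one]
    _ ≤ I * (ENNReal.ofReal c * ENNReal.ofReal (r ^ b) *
      ((ENNReal.ofReal (r ^ b))⁻¹ * (m (Metric.ball x r))⁻¹)) := by gcongr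
    _ = _ := by ring

/-- Comparison of the double integrals of two functions whose difference is small in `L^p`. -/
theorem ksIntegral_le_add (hp : 0 ≤ p) {h : K → ℝ} (hf : Measurable f) (hh : Measurable h) :
    ksIntegral m p r f ≤ ENNReal.ofReal (4 ^ p) *
      (ksIntegral m p r h + 2 * ∫⁻ x, ENNReal.ofReal (|f x - h x| ^ p) ∂m) := by
  set N := ∫⁻ x, ENNReal.ofReal (|f x - h x| ^ p) ∂m with hN
  have hmeas : Measurable fun x => ENNReal.ofReal (|f x - h x| ^ p) := by
    have := (hf.sub hh).abs.pow_const p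
    exact this.ennreal_ofReal
  -- Split `f x - f y` into `h x - h y`, `f x - h x` and `h y - f y`; two uses of the `2 ^ p`
  -- inequality give `4 ^ p`.
  have hpt : ∀ x y, ENNReal.ofReal (|f x - f y| ^ p) ≤ ENNReal.ofReal (4 ^ p) *
      (ENNReal.ofReal (|h x - h y| ^ p) + (ENNReal.ofReal (|f x - h x| ^ p)
        + ENNReal.ofReal (|f y - h y| ^ p))) := fun x y => by
    have e4 : ENNReal.ofReal ((4 : ℝ) ^ p) = ENNReal.ofReal (2 ^ p) * ENNReal.ofReal (2 ^ p) := by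
      rw [← ENNReal.ofReal_mul (by positivity), ← Real.mul_rpow (by norm_num) (by norm_num)]
      norm_num
    have h1 : 1 ≤ ENNReal.ofReal ((2 : ℝ) ^ p) := by
      rw [← ENNReal.ofReal_one]
      exact ENNReal.ofReal_le_ofReal (Real.one_le_rpow (by norm_num) hp)
    have h2 := ofReal_abs_add_rpow_le hp (h x - h y) ((f x - h x) + (h y - f y))
    have h3 := ofReal_abs_add_rpow_le hp (f x - h x) (h y - f y)
    rw [show h x - h y + ((f x - h x) + (h y - f y)) = f x - f y by ring] at h2
    rw [abs_sub_comm (h y) (f y)] at h3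
    rw [e4, mul_assoc]
    refine h2.trans ?_
    gcongr
    rw [mul_add]
    exact add_le_add (le_mul_of_one_le_left zero_le h1) h3
  unfold ksIntegral
  calc ∫⁻ x, ∫⁻ y in Metric.ball x r, ENNReal.ofReal (|f x - f y| ^ p) ∂m ∂m
      ≤ ∫⁻ x, ENNReal.ofReal (4 ^ p) *
        ((∫⁻ y in Metric.ball x r, ENNReal.ofReal (|h x - h y| ^ p) ∂m) +
          (ENNReal.ofReal (|f x - h x| ^ p) + N)) ∂m := by
        refine lintegral_mono fun x => ?_
        calc ∫⁻ y in Metric.ball x r, ENNReal.ofReal (|f x - f y| ^ p) ∂m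
            ≤ ∫⁻ y in Metric.ball x r, ENNReal.ofReal (4 ^ p) *
              (ENNReal.ofReal (|h x - h y| ^ p) + (ENNReal.ofReal (|f x - h x| ^ p)
                + ENNReal.ofReal (|f y - h y| ^ p))) ∂m := lintegral_mono fun y => hpt x y
          _ = ENNReal.ofReal (4 ^ p) * ((∫⁻ y in Metric.ball x r,
              ENNReal.ofReal (|h x - h y| ^ p) ∂m) + (ENNReal.ofReal (|f x - h x| ^ p)
                * m (Metric.ball x r) + ∫⁻ y in Metric.ball x r,
                  ENNReal.ofReal (|f y - h y| ^ p) ∂m)) := by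
              rw [lintegral_const_mul' _ _ ENNReal.ofReal_ne_top,
                lintegral_add_right _ (hmeas.const_add _), lintegral_add_right _ hmeas,
                setLIntegral_const]
          _ ≤ _ := by
              gcongr
              · exact mul_le_of_le_one_right zero_le prob_le_one
              · exact setLIntegral_le_lintegral _ _
    _ = _ := by
        rw [lintegral_const_mul' _ _ ENNReal.ofReal_ne_top,
          lintegral_add_right _ (hmeas.add_const _), lintegral_add_right _ measurable_const,
          ← hN, lintegral_const, measure_univ, mul_one, two_mul]

theorem AhlforsBounds.real_ball_pos {df κ : ℝ} (hm : AhlforsBounds m df κ) (x : K) (hr : 0 < r) :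
    0 < m.real (Metric.ball x r) := by
  have hκ := hm.one_le
  have h1 := hm.lower x (min r 1) (by positivity) (min_le_right _ _)
  have h2 : 0 < (min r 1) ^ df := by positivity
  have h3 : 0 < m.real (Metric.ball x (min r 1)) := by
    by_contra h
    have : κ * m.real (Metric.ball x (min r 1)) ≤ 0 :=
      mul_nonpos_of_nonneg_of_nonpos (by linarith) (not_lt.1 h)
    linarith
  exact h3.trans_le (measureReal_mono (Metric.ball_subset_ball (min_le_left _ _)))

/-- Dividing the radius by `κ` brings it into the range `r ≤ 1` of the lower bound. Radii up to `κ`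
are enough, since `κ` exceeds all distances. -/
theorem AhlforsBounds.lower_of_le {df κ : ℝ} (hm : AhlforsBounds m df κ) (x : K) (hr : 0 < r)
    (hrκ : r ≤ κ) : (r / κ) ^ df / κ ≤ m.real (Metric.ball x r) := by
  have hκ := hm.one_le
  have hκ0 : 0 < κ := by linarith
  rw [div_le_iff₀' hκ0]
  refine (hm.lower x (r / κ) (by positivity) ((div_le_one hκ0).2 hrκ)).trans ?_
  gcongr
  · exact measure_ne_top _ _
  · exact div_le_self hr.le hκ

end KS

/-! ### Step functions: discrete energy controls Korevaar–Schoen energy -/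

section Net

variable {K V : Type*} [MeasurableSpace K] {m : Measure K} [Fintype V]

theorem measurable_comp_fiber {i : K → V} (hi : ∀ v, MeasurableSet (i ⁻¹' {v})) (g : V → ℝ) :
    Measurable fun x => g (i x) := by
  intro s _
  have : (fun x => g (i x)) ⁻¹' s = ⋃ v ∈ {v | g v ∈ s}, i ⁻¹' {v} := by
    ext x; simp
  rw [this]
  exact MeasurableSet.biUnion (Set.to_countable _) fun v _ => hi v

theorem lintegral_eq_sum_fiber {i : K → V} (hi : ∀ v, MeasurableSet (i ⁻¹' {v})) (F : K → ℝ≥0∞) :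
    ∫⁻ x, F x ∂m = ∑ v, ∫⁻ x in i ⁻¹' {v}, F x ∂m := by
  have e := lintegral_iUnion (μ := m) hi (fun u w huw => Set.disjoint_left.2
    fun x hx hx' => huw (hx.symm.trans hx')) F
  have huniv : ⋃ v, i ⁻¹' {v} = Set.univ := Set.eq_univ_of_forall fun x =>
    Set.mem_iUnion.2 ⟨i x, rfl⟩
  rwa [huniv, Measure.restrict_univ, tsum_fintype] at e

theorem lintegral_comp_eq_sum {i : K → V} (hi : ∀ v, MeasurableSet (i ⁻¹' {v})) (H : V → ℝ≥0∞) :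
    ∫⁻ x, H (i x) ∂m = ∑ v, H v * m (i ⁻¹' {v}) := by
  rw [lintegral_eq_sum_fiber hi]
  refine Finset.sum_congr rfl fun v _ => ?_
  rw [setLIntegral_congr_fun (g := fun _ => H v) (hi v) (fun x hx => by
    have : i x = v := hx
    simp [this]), setLIntegral_const]

variable [MetricSpace K] {G : SimpleGraph V} {i : K → V} {df ε κ p r : ℝ}

theorem AhlforsBounds.mono {K : Type*} [MetricSpace K] [MeasurableSpace K]
    {m : Measure K} {κ' : ℝ} (h : AhlforsBounds m df κ) (hκ : κ ≤ κ') :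
    AhlforsBounds m df κ' where
  one_le := h.one_le.trans hκ
  upper x r hr := (h.upper x r hr).trans (by gcongr)
  lower x r hr hr1 := (h.lower x r hr hr1).trans (by gcongr)
  dist_lt x y := (h.dist_lt x y).trans_le hκ

variable [IsProbabilityMeasure m]

theorem IsNet.measure_fiber_le (h : IsNet m G i df ε κ) (hε : 0 < ε) (hκ : 0 ≤ κ) (v : V) :
    m (i ⁻¹' {v}) ≤ ENNReal.ofReal (κ * ε ^ df) :=
  (ENNReal.le_ofReal_iff_toReal_le (measure_ne_top _ _) (by positivity)).2 (h.fiber_upper v)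

theorem IsNet.le_measure_fiber (h : IsNet m G i df ε κ) (hκ : 0 < κ) (v : V) :
    ENNReal.ofReal (ε ^ df / κ) ≤ m (i ⁻¹' {v}) := by
  rw [ENNReal.ofReal_le_iff_le_toReal (measure_ne_top _ _), div_le_iff₀' hκ]
  exact h.fiber_lower v

variable [OpensMeasurableSpace K]

open Classical in
-- As `ε ≤ r`, points at distance less than `r` have indices at graph distance less than `κ (r / ε +
-- 1) ≤ 2κ r / ε`, and a product of two fibres has mass at most `(κ ε ^ df) ^ 2`.
theorem IsNet.ksIntegral_comp_le (h : IsNet m G i df ε κ) (hε : 0 < ε) (hκ : 0 < κ)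
    (hεr : ε ≤ r) (g : V → ℝ) :
    ksIntegral m p r (fun x => g (i x)) ≤ ENNReal.ofReal ((κ * ε ^ df) ^ 2 *
      ∑ v, ∑ w ∈ graphBall G v (2 * κ * r / ε), |g v - g w| ^ p) := by
  set ρ := 2 * κ * r / ε with hρ
  set M := ENNReal.ofReal (κ * ε ^ df) with hM
  set t : V → V → ℝ≥0∞ := fun v w => ENNReal.ofReal (|g v - g w| ^ p) with ht
  have hcell := h.measure_fiber_le hε hκ.le
  have hinner : ∀ x, ∫⁻ y in Metric.ball x r, t (i x) (i y) ∂m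
      ≤ ∑ w ∈ graphBall G (i x) ρ, t (i x) w * M := fun x => by
    calc ∫⁻ y in Metric.ball x r, t (i x) (i y) ∂m
        = ∫⁻ y, (Metric.ball x r).indicator (fun y => t (i x) (i y)) y ∂m :=
          (lintegral_indicator measurableSet_ball _).symm
      _ ≤ ∫⁻ y, (fun w => if w ∈ graphBall G (i x) ρ then t (i x) w else 0) (i y) ∂m := by
          refine lintegral_mono fun y => ?_
          by_cases hy : y ∈ Metric.ball x r
          · have hlt : (G.dist (i x) (i y) : ℝ) < ρ := by
              rw [Metric.mem_ball, dist_comm] at hy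
              have h1 := h.le_dist x y
              have h2 : dist x y / ε < r / ε := by gcongr
              have h3 : 1 ≤ r / ε := (one_le_div hε).2 hεr
              have h4 : ρ = κ * (r / ε + r / ε) := by rw [hρ]; ring
              rw [h4]
              exact h1.trans_lt (mul_lt_mul_of_pos_left (by linarith) hκ)
            simp [hy, mem_graphBall.2 hlt]
          · simp [hy]
      _ = ∑ w ∈ graphBall G (i x) ρ, t (i x) w * m (i ⁻¹' {w}) := by
          rw [lintegral_comp_eq_sum h.measurableSet_fiber
            (fun w => if w ∈ graphBall G (i x) ρ then t (i x) w else 0)]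
          simp
      _ ≤ _ := by gcongr; exact hcell _
  calc ksIntegral m p r (fun x => g (i x))
      ≤ ∫⁻ x, (fun v => ∑ w ∈ graphBall G v ρ, t v w * M) (i x) ∂m := lintegral_mono hinner
    _ = ∑ v, (∑ w ∈ graphBall G v ρ, t v w * M) * m (i ⁻¹' {v}) :=
        lintegral_comp_eq_sum h.measurableSet_fiber (fun v => ∑ w ∈ graphBall G v ρ, t v w * M)
    _ ≤ ∑ v, (∑ w ∈ graphBall G v ρ, t v w * M) * M := by gcongr; exact hcell _
    _ = M ^ 2 * ∑ v, ∑ w ∈ graphBall G v ρ, t v w := by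
        simp_rw [← Finset.sum_mul]; ring
    _ = _ := by
        rw [hM, ENNReal.ofReal_mul (p := (κ * ε ^ df) ^ 2) (by positivity),
          ENNReal.ofReal_pow (by positivity), ENNReal.ofReal_sum_of_nonneg fun v _ => by positivity]
        congr 1
        refine Finset.sum_congr rfl fun v _ => ?_
        rw [ENNReal.ofReal_sum_of_nonneg fun v _ => by positivity]

/-- The Korevaar--Schoen energies of a function which is constant on the cells of a net are
controlled by its discrete energy. -/
theorem IsNet.ksEnergy_comp_le {β A D : ℝ} (h : IsNet m G i df ε κ) (hm : AhlforsBounds m df κ)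
    (hp : 0 ≤ p) (hε : 0 < ε) (hA : 1 ≤ A) (hD : 0 ≤ D)
    (hPI : ∀ (x : V) (R : ℝ), 1 ≤ R → ∀ f : V → ℝ,
      ∑ y ∈ graphBall G x R, |f y - finAvg (graphBall G x R) f| ^ p
        ≤ D * R ^ β * energy G p (graphBall G x (A * R)) f)
    (hεr : ε ≤ r) (hrκ : r ≤ κ) (g : V → ℝ) :
    ksEnergy m p β r (fun x => g (i x)) ≤ ENNReal.ofReal
      (2 ^ (p + 1) * κ ^ 6 * (κ ^ df) ^ 2 * ((4 * A * κ) ^ df) ^ 2 * (D * (4 * κ) ^ β) *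
        (ε ^ df / ε ^ β * energy G p Finset.univ g)) := by
  have hκ := hm.one_le
  have hκ0 : 0 < κ := by linarith
  have hr : 0 < r := hε.trans_le hεr
  set ρ := 2 * κ * r / ε with hρ
  have hρ1 : 1 ≤ r / ε := (one_le_div hε).2 hεr
  have hρ2 : 2 ≤ ρ := by
    rw [hρ, mul_div_assoc]; nlinarith
  have hlow : ∀ v, (r / ε) ^ df / (κ ^ df * κ) ≤ ((graphBall G v ρ).card : ℝ) := fun v => by
    -- The lower count is valid only up to radius `1 / ε`; since `r ≤ κ`, the radius `r / (ε κ)` is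
    -- admissible.
    have h1 := h.le_card v (r / (ε * κ)) (by positivity) (by
      rw [show r / (ε * κ) * ε = r / κ by field_simp]
      exact (div_le_one hκ0).2 hrκ)
    rw [← div_div, Real.div_rpow (by positivity) hκ0.le, ← div_le_iff₀' hκ0, div_div] at h1
    refine h1.trans ?_
    have hsub : r / ε / κ ≤ ρ := by
      refine (div_le_self (by positivity) hκ).trans ?_
      rw [hρ, mul_div_assoc]
      exact le_mul_of_one_le_left (by positivity) (by linarith)
    exact_mod_cast Finset.card_le_card (graphBall_mono v hsub)
  have hup : ∀ v, ((graphBall G v (A * (2 * ρ))).card : ℝ) ≤ κ * ((4 * A * κ) ^ df * (r / ε) ^ df)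
    := fun v => by
    refine (h.card_le v _ (by nlinarith)).trans (le_of_eq ?_)
    rw [← Real.mul_rpow (by positivity) (by positivity), hρ]
    congr 2; ring
  have hsum := sum_graphBall_abs_sub_rpow_le h.connected hp (by linarith) hA
    (D := D * (2 * ρ) ^ β) (by positivity)
    (fun x f => hPI x (2 * ρ) (by linarith) f) hlow hup g
  have e2ρ : (2 * ρ) ^ β = (4 * κ) ^ β * (r ^ β / ε ^ β) := by
    rw [← Real.div_rpow hr.le hε.le, ← Real.mul_rpow (by positivity) (by positivity), hρ]
    congr 1; ring
  refine (ksEnergy_le_ksIntegral hr (c := r ^ df / (κ ^ df * κ)) (by positivity) fun x => by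
    rw [← div_div, ← Real.div_rpow hr.le hκ0.le]; exact hm.lower_of_le x hr hrκ).trans ?_
  refine (mul_le_mul_right (h.ksIntegral_comp_le hε hκ0 hεr g) _).trans ?_
  rw [← ENNReal.ofReal_mul (by positivity)]
  refine ENNReal.ofReal_le_ofReal ?_
  have hrp : 0 < r ^ df := by positivity
  have hεp : 0 < ε ^ df := by positivity
  have hrβ : 0 < r ^ β := by positivity
  have hεβ : 0 < ε ^ β := by positivity
  have hκp : 0 < κ ^ df := by positivity
  -- Up to constants the double sum is at most `(r / ε) ^ (df + β)` times the discrete energy. The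
  -- prefactor `ε ^ (2 df) / r ^ (df + β)` removes `r` and leaves `ε ^ (df - β)`.
  rw [e2ρ, Real.div_rpow hr.le hε.le, ← le_div_iff₀' (by positivity)] at hsum
  refine (mul_le_mul_of_nonneg_left (mul_le_mul_of_nonneg_left hsum (by positivity))
    (by positivity)).trans (le_of_eq ?_)
  field_simp

end Net

/-! ### Cell averages: Korevaar–Schoen energy controls discrete energy -/

section Average

variable {K V : Type*} [MetricSpace K] [MeasurableSpace K] {m : Measure K} [Fintype V]
  [IsProbabilityMeasure m] {G : SimpleGraph V} {i : K → V} {df ε κ p r : ℝ} {f : K → ℝ}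

open Classical in
-- Jensen's inequality is applied twice, in each of two adjacent cells. The neighbouring cells of
-- `v` are disjoint and lie within `2κε`, hence strictly within `r`, of every point of the cell of
-- `v`, so their contributions add up to at most an integral over a ball.
theorem IsNet.sum_average_le_ksIntegral (h : IsNet m G i df ε κ) (hε : 0 < ε) (hκ : 0 < κ)
    (hp : 1 ≤ p) (hr : 3 * κ * ε ≤ r) (hfm : Measurable f) (hf : Integrable f m) :
    ∑ v, ∑ w ∈ Finset.univ.filter (fun w => G.Adj v w), ENNReal.ofReal
      (|(⨍ x in i ⁻¹' {v}, f x ∂m) - ⨍ y in i ⁻¹' {w}, f y ∂m| ^ p)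
        * m (i ⁻¹' {v}) * m (i ⁻¹' {w}) ≤ ksIntegral m p r f := by
  unfold ksIntegral
  rw [lintegral_eq_sum_fiber h.measurableSet_fiber]
  refine Finset.sum_le_sum fun v _ => ?_
  set N := Finset.univ.filter fun w => G.Adj v w with hN
  set M : V → ℝ := fun w => ⨍ y in i ⁻¹' {w}, f y ∂m with hM
  have hdisj : (N : Set V).PairwiseDisjoint fun w => i ⁻¹' {w} := fun a _ b _ hab =>
    Set.disjoint_left.2 fun x hx hx' => hab (hx.symm.trans hx')
  calc ∑ w ∈ N, ENNReal.ofReal (|M v - M w| ^ p) * m (i ⁻¹' {v}) * m (i ⁻¹' {w})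
      ≤ ∑ w ∈ N, (∫⁻ x in i ⁻¹' {v}, ENNReal.ofReal (|f x - M w| ^ p) ∂m) * m (i ⁻¹' {w}) := by
        gcongr with w _
        exact ofReal_abs_setAverage_sub_rpow_mul_le hp (measure_ne_top _ _) hf.integrableOn _
    _ = ∫⁻ x in i ⁻¹' {v}, ∑ w ∈ N, ENNReal.ofReal (|f x - M w| ^ p) * m (i ⁻¹' {w}) ∂m := by
        rw [lintegral_finsetSum]
        · refine Finset.sum_congr rfl fun w _ => ?_
          rw [lintegral_mul_const' _ _ (measure_ne_top _ _)]
        · intro w _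
          exact (((hfm.sub_const _).abs.pow_const p).ennreal_ofReal).mul_const _
    _ ≤ ∫⁻ x in i ⁻¹' {v}, ∑ w ∈ N, ∫⁻ y in i ⁻¹' {w}, ENNReal.ofReal (|f x - f y| ^ p) ∂m ∂m := by
        gcongr with x w _
        simp_rw [abs_sub_comm (f x)]
        exact ofReal_abs_setAverage_sub_rpow_mul_le hp (measure_ne_top _ _) hf.integrableOn _
    _ ≤ _ := by
        refine setLIntegral_mono' (h.measurableSet_fiber v) fun x hx => ?_
        rw [← lintegral_biUnion_finset hdisj fun w _ => h.measurableSet_fiber w]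
        refine lintegral_mono_set (Set.iUnion₂_subset fun w hw y hy => ?_)
        have hx : i x = v := hx
        have hy : i y = w := hy
        have hvw : G.Adj v w := (Finset.mem_filter.1 hw).2
        have h1 := h.dist_le y x
        rw [hx, hy, SimpleGraph.dist_eq_one_iff_adj.2 hvw.symm] at h1
        rw [Metric.mem_ball]
        have : 0 < κ * ε := by positivity
        push_cast at h1
        linarith

/-- The discrete energy of the averages of `f` over the cells of a net is controlled by the
Korevaar--Schoen energies of `f` at comparable scales. -/
theorem IsNet.energy_average_le_ksEnergy {β R : ℝ} (h : IsNet m G i df ε κ)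
    (hm : AhlforsBounds m df κ) (hp : 1 ≤ p) (hdf : 0 ≤ df) (hβ : 0 ≤ β) (hε : 0 < ε)
    (hr : 3 * κ * ε ≤ r) (hrR : r ≤ R * ε)
    (hfm : Measurable f) (hf : Integrable f m) :
    ENNReal.ofReal (ε ^ df / ε ^ β *
        energy G p Finset.univ (fun v => ⨍ x in i ⁻¹' {v}, f x ∂m))
      ≤ ENNReal.ofReal (κ ^ 3 * (R ^ df * R ^ β)) * ksEnergy m p β r f := by
  classical
  have hκ := hm.one_le
  have hκ0 : 0 < κ := by linarith
  have hr0 : 0 < r := lt_of_lt_of_le (by positivity) hr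
  have hR0 : 0 < R := by
    by_contra hR
    have : R * ε ≤ 0 := mul_nonpos_of_nonpos_of_nonneg (not_lt.1 hR) hε.le
    linarith
  set M : V → ℝ := fun v => ⨍ x in i ⁻¹' {v}, f x ∂m with hM
  have h1 : ENNReal.ofReal ((ε ^ df / κ) ^ 2 * energy G p Finset.univ M) ≤ ksIntegral m p r f := by
    refine le_trans ?_ (h.sum_average_le_ksIntegral hε hκ0 hp hr hfm hf)
    have h2 : energy G p Finset.univ M
        ≤ ∑ v, ∑ w ∈ Finset.univ.filter (fun w => G.Adj v w), |M v - M w| ^ p := by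
      unfold energy
      simp_rw [Finset.sum_filter]
      have h0 : 0 ≤ ∑ x, ∑ y, if G.Adj x y then |M x - M y| ^ p else 0 :=
        Finset.sum_nonneg fun x _ => Finset.sum_nonneg fun y _ => by split_ifs <;> positivity
      linarith
    calc ENNReal.ofReal ((ε ^ df / κ) ^ 2 * energy G p Finset.univ M)
        ≤ ENNReal.ofReal ((ε ^ df / κ) ^ 2 *
          ∑ v, ∑ w ∈ Finset.univ.filter (fun w => G.Adj v w), |M v - M w| ^ p) := by gcongr
      _ = ∑ v, ∑ w ∈ Finset.univ.filter (fun w => G.Adj v w),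
          ENNReal.ofReal (|M v - M w| ^ p) * ENNReal.ofReal (ε ^ df / κ) *
            ENNReal.ofReal (ε ^ df / κ) := by
          simp_rw [← Finset.sum_mul]
          rw [ENNReal.ofReal_mul (by positivity), ENNReal.ofReal_pow (by positivity),
            ENNReal.ofReal_sum_of_nonneg fun v _ => by positivity, mul_assoc, ← pow_two, mul_comm]
          congr 1
          refine Finset.sum_congr rfl fun v _ => ?_
          rw [ENNReal.ofReal_sum_of_nonneg fun v _ => by positivity]
      _ ≤ _ := by
          gcongr <;> exact h.le_measure_fiber hκ0 _
  have h2 := h1.trans (ksIntegral_le_ksEnergy (b := β) hr0 (c := κ * r ^ df) (by positivity)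
    (fun x => hm.real_ball_pos x hr0) (fun x => hm.upper x r hr0))
  have hεp : 0 < ε ^ df := by positivity
  have hεβ : 0 < ε ^ β := by positivity
  have e1 : ε ^ df / ε ^ β * energy G p Finset.univ M = κ ^ 2 / (ε ^ df * ε ^ β) *
      ((ε ^ df / κ) ^ 2 * energy G p Finset.univ M) := by field_simp
  rw [e1, ENNReal.ofReal_mul (by positivity)]
  refine (mul_le_mul_right h2 _).trans ?_
  rw [← mul_assoc, ← ENNReal.ofReal_mul (by positivity)]
  -- Only the ratio `r / ε` survives, and it is at most `R`.
  have e2 : κ ^ 2 / (ε ^ df * ε ^ β) * (κ * r ^ df * r ^ β)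
      = κ ^ 3 * ((r / ε) ^ df * (r / ε) ^ β) := by
    rw [Real.div_rpow hr0.le hε.le, Real.div_rpow hr0.le hε.le]; field_simp
  have hrε : r / ε ≤ R := (div_le_iff₀ hε).2 hrR
  rw [e2]
  gcongr

/-- Pass through `h`, whose oscillation on fibres is at most `ω`. By Jensen's inequality the
distance from the average of `f` to `h x` is controlled by the fibre average of `|f - h| ^ p` and by
`ω ^ p`; integrating fibre averages gives back the full integral. -/
theorem IsNet.lintegral_sub_average_le {h : K → ℝ} {ω : ℝ} (hn : IsNet m G i df ε κ) (hε : 0 < ε)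
    (hp : 1 ≤ p) (hfm : Measurable f) (hf : Integrable f m) (hh : Measurable h)
    (hω : ∀ x y, i x = i y → |h x - h y| ≤ ω) :
    ∫⁻ x, ENNReal.ofReal (|f x - ⨍ y in i ⁻¹' {i x}, f y ∂m| ^ p) ∂m
      ≤ ENNReal.ofReal (2 ^ p) * ((∫⁻ x, ENNReal.ofReal (|f x - h x| ^ p) ∂m)
        + ENNReal.ofReal (2 ^ p) * ((∫⁻ x, ENNReal.ofReal (|f x - h x| ^ p) ∂m)
          + ENNReal.ofReal (ω ^ p))) := by
  have hp0 : 0 ≤ p := by linarith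
  set M : V → ℝ := fun v => ⨍ y in i ⁻¹' {v}, f y ∂m with hM
  set u : K → ℝ≥0∞ := fun x => ENNReal.ofReal (|f x - h x| ^ p) with hu
  have humeas : Measurable u := ((hfm.sub hh).abs.pow_const p).ennreal_ofReal
  have hpos : ∀ v, m (i ⁻¹' {v}) ≠ 0 := fun v h0 => by
    have h1 := hn.fiber_lower v
    have h2 : 0 < ε ^ df := by positivity
    simp only [Measure.real, h0, ENNReal.toReal_zero, mul_zero] at h1
    linarith
  set S : V → ℝ≥0∞ := fun v => ∫⁻ y in i ⁻¹' {v}, u y ∂m with hS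
  have hMh : ∀ x, ENNReal.ofReal (|M (i x) - h x| ^ p)
      ≤ ENNReal.ofReal (2 ^ p) * (S (i x) / m (i ⁻¹' {i x}) + ENNReal.ofReal (ω ^ p)) := fun x => by
    have h1 := ofReal_abs_setAverage_sub_rpow_mul_le hp (measure_ne_top m (i ⁻¹' {i x}))
      hf.integrableOn (h x)
    have h2 : ∫⁻ y in i ⁻¹' {i x}, ENNReal.ofReal (|f y - h x| ^ p) ∂m
        ≤ ENNReal.ofReal (2 ^ p) * (S (i x) + ENNReal.ofReal (ω ^ p) * m (i ⁻¹' {i x})) := by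
      calc _ ≤ ∫⁻ y in i ⁻¹' {i x}, ENNReal.ofReal (2 ^ p) * (u y + ENNReal.ofReal (ω ^ p)) ∂m := by
            refine setLIntegral_mono' (hn.measurableSet_fiber _) fun y hy => ?_
            have h3 := ofReal_abs_add_rpow_le hp0 (f y - h y) (h y - h x)
            rw [show f y - h y + (h y - h x) = f y - h x by ring] at h3
            refine h3.trans ?_
            gcongr
            exact hω y x hy
        _ = _ := by
            rw [lintegral_const_mul' _ _ ENNReal.ofReal_ne_top,
              lintegral_add_right _ measurable_const, setLIntegral_const]
    have h3 := h1.trans h2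
    rw [← ENNReal.le_div_iff_mul_le (Or.inl (hpos _)) (Or.inl (measure_ne_top _ _))] at h3
    refine h3.trans (le_of_eq ?_)
    rw [mul_div_assoc, ENNReal.add_div, ENNReal.mul_div_cancel_right (hpos _) (measure_ne_top _ _)]
  have hSint : ∫⁻ x, S (i x) / m (i ⁻¹' {i x}) ∂m = ∫⁻ x, u x ∂m := by
    rw [lintegral_comp_eq_sum hn.measurableSet_fiber (fun v => S v / m (i ⁻¹' {v})),
      lintegral_eq_sum_fiber hn.measurableSet_fiber u]
    exact Finset.sum_congr rfl fun v _ => ENNReal.div_mul_cancel (hpos v) (measure_ne_top _ _)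
  calc ∫⁻ x, ENNReal.ofReal (|f x - M (i x)| ^ p) ∂m
      ≤ ∫⁻ x, ENNReal.ofReal (2 ^ p) * (u x + ENNReal.ofReal (2 ^ p) *
          (S (i x) / m (i ⁻¹' {i x}) + ENNReal.ofReal (ω ^ p))) ∂m := by
        refine lintegral_mono fun x => ?_
        have h3 := ofReal_abs_add_rpow_le hp0 (f x - h x) (h x - M (i x))
        rw [show f x - h x + (h x - M (i x)) = f x - M (i x) by ring,
          abs_sub_comm (h x) (M (i x))] at h3
        refine h3.trans ?_
        gcongr
        exact hMh x
    _ = _ := by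
        rw [lintegral_const_mul' _ _ ENNReal.ofReal_ne_top, lintegral_add_left humeas,
          lintegral_const_mul' _ _ ENNReal.ofReal_ne_top,
          lintegral_add_right _ measurable_const, hSint, lintegral_const, measure_univ, mul_one]

theorem exists_continuous_lintegral_sub_le [CompactSpace K] [BorelSpace K] (hp : 1 ≤ p)
    (hf : MemLp f (ENNReal.ofReal p) m) {η : ℝ≥0∞} (hη : η ≠ 0) :
    ∃ h : K → ℝ, Continuous h ∧ ∫⁻ x, ENNReal.ofReal (|f x - h x| ^ p) ∂m ≤ η := by
  have hp0 : 0 < p := by linarith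
  have hη' : η ^ (1 / p) ≠ 0 := by
    rw [Ne, ENNReal.rpow_eq_zero_iff]
    push Not
    exact ⟨fun h => absurd h hη, fun h => by positivity⟩
  obtain ⟨g, hg, -⟩ := hf.exists_boundedContinuous_eLpNorm_sub_le ENNReal.ofReal_ne_top hη'
  refine ⟨g, g.continuous, ?_⟩
  rw [eLpNorm_eq_lintegral_rpow_enorm_toReal (by simpa using hp0) ENNReal.ofReal_ne_top,
    ENNReal.toReal_ofReal hp0.le, ENNReal.rpow_le_rpow_iff (by positivity)] at hg
  simp_rw [ofReal_abs_rpow hp0.le]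
  exact hg

end Average

/-! ### Passage to the limit along the levels -/

section Limit

variable {K : Type*} [MetricSpace K] [MeasurableSpace K] {m : Measure K} [IsProbabilityMeasure m]
  {df κ p β r R : ℝ} {f : K → ℝ}

/-- The factor in front of the energy of `h` does not depend on `r`. The one in front of the `L^p`
error does, but it is finite, which suffices when `h` approaches `f` at fixed `r`. -/
theorem AhlforsBounds.ksEnergy_le_add (hm : AhlforsBounds m df κ) (hp : 0 ≤ p)
    (hr : 0 < r) (hrκ : r ≤ κ) {h : K → ℝ} (hf : Measurable f) (hh : Measurable h) :
    ksEnergy m p β r f ≤ ENNReal.ofReal (4 ^ p * (κ ^ 2 * κ ^ df)) * ksEnergy m p β r h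
      + ENNReal.ofReal (((r / κ) ^ df / κ * r ^ β)⁻¹) * ENNReal.ofReal (4 ^ p) * 2 *
        ∫⁻ x, ENNReal.ofReal (|f x - h x| ^ p) ∂m := by
  have hκ := hm.one_le
  have hκ0 : 0 < κ := by linarith
  set c := (r / κ) ^ df / κ with hc
  calc ksEnergy m p β r f ≤ ENNReal.ofReal ((c * r ^ β)⁻¹) * ksIntegral m p r f :=
        ksEnergy_le_ksIntegral hr (by positivity) fun x => hm.lower_of_le x hr hrκ
    _ ≤ ENNReal.ofReal ((c * r ^ β)⁻¹) * (ENNReal.ofReal (4 ^ p) *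
        (ksIntegral m p r h + 2 * ∫⁻ x, ENNReal.ofReal (|f x - h x| ^ p) ∂m)) := by
        gcongr; exact ksIntegral_le_add hp hf hh
    _ ≤ ENNReal.ofReal ((c * r ^ β)⁻¹) * (ENNReal.ofReal (4 ^ p) *
        (ENNReal.ofReal (κ * r ^ df * r ^ β) * ksEnergy m p β r h
          + 2 * ∫⁻ x, ENNReal.ofReal (|f x - h x| ^ p) ∂m)) := by
        gcongr
        exact ksIntegral_le_ksEnergy hr (by positivity) (fun x => hm.real_ball_pos x hr)
          fun x => hm.upper x r hr
    _ = ENNReal.ofReal ((c * r ^ β)⁻¹) * ENNReal.ofReal (4 ^ p) *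
        ENNReal.ofReal (κ * r ^ df * r ^ β) * ksEnergy m p β r h
          + ENNReal.ofReal ((c * r ^ β)⁻¹) * ENNReal.ofReal (4 ^ p) * 2 *
            ∫⁻ x, ENNReal.ofReal (|f x - h x| ^ p) ∂m := by ring
    _ = _ := by
        rw [← ENNReal.ofReal_mul (by positivity), ← ENNReal.ofReal_mul (by positivity)]
        congr 3
        rw [hc, Real.div_rpow hr.le hκ0.le]
        have h1 : 0 < r ^ df := by positivity
        have h2 : 0 < r ^ β := by positivity
        field_simp

theorem tendsto_inv_pow_zero (hR : 1 < R) : Tendsto (fun n : ℕ => (R ^ n)⁻¹) atTop (𝓝 0) :=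
  tendsto_inv_atTop_zero.comp (tendsto_pow_atTop_atTop_of_one_lt hR)

variable [CompactSpace K] [BorelSpace K] {V : ℕ → Type*} [∀ n, Fintype (V n)]
  {G : ∀ n, SimpleGraph (V n)} {i : ∀ n, K → V n}

/-- The averages of an `L^p` function over the cells of finer and finer nets converge in `L^p`. -/
theorem tendsto_lintegral_sub_average (hR : 1 < R) (hp : 1 ≤ p)
    (hi : ∀ n, 1 ≤ n → IsNet m (G n) (i n) df (R ^ n)⁻¹ κ)
    (hfm : Measurable f) (hf : MemLp f (ENNReal.ofReal p) m) :
    Tendsto (fun n => ∫⁻ x, ENNReal.ofReal (|f x - ⨍ y in i n ⁻¹' {i n x}, f y ∂m| ^ p) ∂m)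
      atTop (𝓝 0) := by
  have hp0 : 0 < p := by linarith
  have hfi : Integrable f m := hf.integrable (by simpa using hp)
  rw [ENNReal.tendsto_nhds_zero]
  intro η hη
  set P := ENNReal.ofReal ((2 : ℝ) ^ p)
  have hP : P ≠ ⊤ := ENNReal.ofReal_ne_top
  have ht : Tendsto (fun t : ℝ≥0∞ => P * (t + P * (t + t))) (𝓝 0) (𝓝 0) := by
    have h2 : Tendsto (fun t : ℝ≥0∞ => t + t) (𝓝 0) (𝓝 0) := by
      simpa using (tendsto_id (x := 𝓝 (0 : ℝ≥0∞))).add tendsto_id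
    have h3 : Tendsto (fun t : ℝ≥0∞ => P * (t + t)) (𝓝 0) (𝓝 0) := by
      simpa using ENNReal.Tendsto.const_mul h2 (Or.inr hP)
    have h4 : Tendsto (fun t : ℝ≥0∞ => t + P * (t + t)) (𝓝 0) (𝓝 0) := by
      simpa using (tendsto_id (x := 𝓝 (0 : ℝ≥0∞))).add h3
    simpa using ENNReal.Tendsto.const_mul h4 (Or.inr hP)
  -- The number `t` bounds both the `L^p` error of a continuous approximation `h` and `ω ^ p`, where
  -- `ω` is the oscillation of `h` on fibres, of diameter at most `κ R⁻ⁿ`.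
  obtain ⟨t, ht1, ht0⟩ := (((ht.mono_left nhdsWithin_le_nhds).eventually
    (ge_mem_nhds hη)).and (self_mem_nhdsWithin (s := Set.Ioi (0 : ℝ≥0∞)))).exists
  obtain ⟨h, hhc, hh⟩ := exists_continuous_lintegral_sub_le hp hf (ne_of_gt ht0)
  have hω : Tendsto (fun ω : ℝ => ENNReal.ofReal (ω ^ p)) (𝓝 0) (𝓝 0) := by
    have h1 : Tendsto (fun ω : ℝ => ω ^ p) (𝓝 0) (𝓝 (0 ^ p)) :=
      (Real.continuousAt_rpow_const 0 p (Or.inr hp0.le)).tendsto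
    rw [Real.zero_rpow hp0.ne'] at h1
    simpa using ENNReal.tendsto_ofReal h1
  obtain ⟨ω, hω1, hω0⟩ := (((hω.mono_left nhdsWithin_le_nhds).eventually
    (ge_mem_nhds ht0)).and (self_mem_nhdsWithin (s := Set.Ioi (0 : ℝ)))).exists
  obtain ⟨δ, hδ, hhδ⟩ := Metric.uniformContinuous_iff.1
    (CompactSpace.uniformContinuous_of_continuous hhc) ω hω0
  have hε : Tendsto (fun n : ℕ => κ * (R ^ n)⁻¹) atTop (𝓝 0) := by
    simpa using (tendsto_inv_pow_zero hR).const_mul κ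
  filter_upwards [hε.eventually (gt_mem_nhds hδ), eventually_ge_atTop 1] with n hn hn1
  refine ((hi n hn1).lintegral_sub_average_le (by positivity) hp hfm hfi hhc.measurable
    (ω := ω) fun x y hxy => ?_).trans (le_trans ?_ ht1)
  · refine (hhδ ?_).le
    have h1 := (hi n hn1).dist_le x y
    rw [hxy, SimpleGraph.dist_self] at h1
    simp only [Nat.cast_zero, zero_add, mul_one] at h1
    exact h1.trans_lt hn
  · change P * _ ≤ _
    gcongr

/-- The Korevaar--Schoen energies at all scales are controlled by the limit inferior of the
discrete energies of the averages. -/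
theorem ksEnergy_le_liminf {A D : ℝ} (hR : 1 < R) (hp : 1 ≤ p) (hA : 1 ≤ A) (hD : 1 ≤ D)
    (hβ : 0 ≤ β) (hm : AhlforsBounds m df κ)
    (hi : ∀ n, 1 ≤ n → IsNet m (G n) (i n) df (R ^ n)⁻¹ κ) (hPI : UniformPoincare G p β D A)
    (hfm : Measurable f) (hf : MemLp f (ENNReal.ofReal p) m) (hr : 0 < r) :
    ksEnergy m p β r f ≤ ENNReal.ofReal (4 ^ p * (κ ^ 2 * κ ^ df)) * (ENNReal.ofReal
      (2 ^ (p + 1) * κ ^ 6 * (κ ^ df) ^ 2 * ((4 * A * κ) ^ df) ^ 2 * (D * (4 * κ) ^ β)) *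
      liminf (fun n : ℕ => ENNReal.ofReal (((R ^ n)⁻¹) ^ df / ((R ^ n)⁻¹) ^ β *
        energy (G n) p Finset.univ fun v => ⨍ x in i n ⁻¹' {v}, f x ∂m)) atTop) := by
  have hκ := hm.one_le
  have hκ0 : 0 < κ := by linarith
  wlog hrκ : r ≤ κ generalizing r
  · exact (ksEnergy_le_of_univ hκ0 hβ (not_le.1 hrκ).le hm.dist_lt).trans (this hκ0 le_rfl)
  set Q := 2 ^ (p + 1) * κ ^ 6 * (κ ^ df) ^ 2 * ((4 * A * κ) ^ df) ^ 2 * (D * (4 * κ) ^ β) with hQ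
  have hQ0 : 0 < Q := by positivity
  set e : ℕ → ℝ≥0∞ := fun n => ENNReal.ofReal (((R ^ n)⁻¹) ^ df / ((R ^ n)⁻¹) ^ β *
        energy (G n) p Finset.univ fun v => ⨍ x in i n ⁻¹' {v}, f x ∂m) with he
  set N : ℕ → ℝ≥0∞ := fun n =>
    ∫⁻ x, ENNReal.ofReal (|f x - ⨍ y in i n ⁻¹' {i n x}, f y ∂m| ^ p) ∂m with hN
  -- The factor `B` depends on `r` but not on `n`, so the error `B * N n` tends to zero.
  set B : ℝ≥0∞ := ENNReal.ofReal (((r / κ) ^ df / κ * r ^ β)⁻¹) * ENNReal.ofReal (4 ^ p) * 2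
  have hB : B ≠ ⊤ := by finiteness
  set c := ENNReal.ofReal (4 ^ p * (κ ^ 2 * κ ^ df)) with hc
  have hc0 : c ≠ 0 := by
    rw [hc, Ne, ENNReal.ofReal_eq_zero, not_le]; positivity
  have hQ0' : ENNReal.ofReal Q ≠ 0 := by rwa [Ne, ENNReal.ofReal_eq_zero, not_le]
  have hle : ∀ᶠ n in atTop, ksEnergy m p β r f ≤ c * (ENNReal.ofReal Q * e n) + B * N n := by
    filter_upwards [(tendsto_inv_pow_zero hR).eventually (ge_mem_nhds hr),
      eventually_ge_atTop 1] with n hn hn1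
    refine (hm.ksEnergy_le_add (by linarith) hr hrκ hfm (measurable_comp_fiber
      (hi n hn1).measurableSet_fiber (fun v => ⨍ y in i n ⁻¹' {v}, f y ∂m))).trans ?_
    gcongr
    have h1 := (hi n hn1).ksEnergy_comp_le hm (p := p) (by linarith) (by positivity) hA
      (by linarith) (hPI n hn1) hn hrκ (fun v => ⨍ y in i n ⁻¹' {v}, f y ∂m)
    rwa [ENNReal.ofReal_mul (by positivity)] at h1
  have hBN : Tendsto (fun n => B * N n) atTop (𝓝 0) := by
    simpa using ENNReal.Tendsto.const_mul (tendsto_lintegral_sub_average hR hp hi hfm hf)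
      (Or.inr hB)
  calc ksEnergy m p β r f ≤ liminf (fun n => c * (ENNReal.ofReal Q * e n) + B * N n) atTop :=
        le_liminf_of_le (by isBoundedDefault) hle
    _ = liminf (fun n => c * (ENNReal.ofReal Q * e n)) atTop :=
        ENNReal.liminf_add_of_right_tendsto_zero hBN _
    _ = _ := by
        rw [ENNReal.liminf_const_mul_of_ne_zero_of_ne_top hc0 ENNReal.ofReal_ne_top,
          ENNReal.liminf_const_mul_of_ne_zero_of_ne_top hQ0' ENNReal.ofReal_ne_top]

end Limit

/-- Consecutive windows `[κ R⁻ⁿ, κ R¹⁻ⁿ]` share an end point, so every small `r` lies in a window of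
large index. -/
theorem liminf_nat_le_liminf_nhdsGT {R κ : ℝ} (hR : 1 < R) (hκ : 0 < κ) {c : ℝ≥0∞} (hc0 : c ≠ 0)
    (hc : c ≠ ⊤) {e : ℕ → ℝ≥0∞} {F : ℝ → ℝ≥0∞}
    (h : ∀ n, 1 ≤ n → ∀ r, κ * (R ^ n)⁻¹ ≤ r → r ≤ κ * R * (R ^ n)⁻¹ → e n ≤ c * F r) :
    liminf e atTop ≤ c * liminf F (𝓝[>] 0) := by
  rw [← ENNReal.liminf_const_mul_of_ne_zero_of_ne_top hc0 hc]
  refine le_of_forall_lt fun d hd => ?_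
  obtain ⟨d', hdd', hd'⟩ := exists_between hd
  obtain ⟨N, hN⟩ := eventually_atTop.1 (eventually_lt_of_lt_liminf hd')
  refine hdd'.trans_le (le_liminf_of_le (by isBoundedDefault) ?_)
  have hpos : 0 < κ * (R ^ N)⁻¹ := by positivity
  filter_upwards [Ioo_mem_nhdsGT hpos] with r ⟨hr0, hr⟩
  have hr' : R ^ N < κ / r := by
    rw [← div_eq_mul_inv, lt_div_iff₀ (by positivity)] at hr
    rw [lt_div_iff₀ hr0]; linarith
  obtain ⟨n, hn1, hn2⟩ := exists_nat_pow_near ((one_le_pow₀ hR.le).trans hr'.le) hR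
  have hNn : N < n + 1 := (pow_lt_pow_iff_right₀ hR).1 (hr'.trans hn2)
  refine (hN (n + 1) hNn.le).le.trans (h (n + 1) (by omega) r ?_ ?_)
  · rw [div_lt_iff₀ hr0] at hn2
    rw [← div_eq_mul_inv, div_le_iff₀ (by positivity)]
    linarith
  · rw [le_div_iff₀ hr0] at hn1
    have : κ * R * (R ^ (n + 1))⁻¹ = κ / R ^ n := by
      rw [pow_succ]; field_simp
    rw [this, le_div_iff₀ (by positivity)]
    linarith

theorem exists_pos_tendsto_le {φ : ℝ → ℝ} (h : Tendsto φ (𝓝 0) (𝓝 0)) {η : ℝ} (hη : 0 < η) :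
    ∃ δ, 0 < δ ∧ φ δ ≤ η :=
  (((h.mono_left nhdsWithin_le_nhds).eventually (ge_mem_nhds hη)).and
    (self_mem_nhdsWithin (s := Set.Ioi (0 : ℝ)))).exists.imp fun _ h => ⟨h.2, h.1⟩

/-- A sequence of functions with values in `[0, 1]` which are equicontinuous up to errors tending
to zero has a uniform limit along some ultrafilter finer than `atTop`, and the limit is
continuous. -/
theorem exists_ultrafilter_uniform_limit {K : Type*} [MetricSpace K] [CompactSpace K]
    {F : ℕ → K → ℝ} {ε : ℕ → ℝ} {H : ℝ → ℝ} (hF : ∀ᶠ n in atTop, ∀ x, F n x ∈ Set.Icc (0 : ℝ) 1)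
    (hε : Tendsto ε atTop (𝓝 0)) (hH : Tendsto H (𝓝 0) (𝓝 0)) (hmono : MonotoneOn H (Set.Ici 0))
    (hε0 : ∀ n, 0 ≤ ε n)
    (heq : ∀ᶠ n in atTop, ∀ x y, |F n x - F n y| ≤ H (dist x y + ε n)) :
    ∃ (U : Ultrafilter ℕ) (f : K → ℝ), (U : Filter ℕ) ≤ atTop ∧ Continuous f ∧
      ∀ η, 0 < η → ∀ᶠ n in (U : Filter ℕ), ∀ x, |f x - F n x| ≤ η := by
  -- Along an ultrafilter, compactness of `[0, 1]` gives pointwise limits at all points at once,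
  -- without extracting subsequences.
  set U : Ultrafilter ℕ := hyperfilter ℕ
  have hU : (U : Filter ℕ) ≤ atTop := Nat.hyperfilter_le_atTop
  have hlim : ∀ x, ∃ l, Tendsto (fun n => F n x) U (𝓝 l) := fun x => by
    obtain ⟨l, -, hl⟩ := isCompact_Icc.ultrafilter_le_nhds (U.map fun n => F n x)
      (le_principal_iff.2 ((hF.filter_mono hU).mono fun n hn => hn x))
    exact ⟨l, hl⟩
  choose f hf using hlim
  have hclose : ∀ η, 0 < η → ∃ δ, 0 < δ ∧ (∀ᶠ n in (U : Filter ℕ), ∀ x y, dist x y < δ →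
      |F n x - F n y| ≤ η) ∧ ∀ x y, dist x y < δ → |f x - f y| ≤ η := fun η hη => by
    -- The argument of `H` is doubled because the distance and the error `ε n` are each kept below
    -- `δ`.
    have h2 : Tendsto (fun t : ℝ => H (t + t)) (𝓝 0) (𝓝 0) :=
      hH.comp (by simpa using (tendsto_id (x := 𝓝 (0 : ℝ))).add tendsto_id)
    obtain ⟨δ, hδ0, hδ⟩ := exists_pos_tendsto_le h2 hη
    have h1 : ∀ᶠ n in (U : Filter ℕ), ∀ x y, dist x y < δ → |F n x - F n y| ≤ η := by
      filter_upwards [hU (heq.and (hε.eventually (ge_mem_nhds hδ0)))] with n hn x y hxy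
      refine (hn.1 x y).trans ((hmono ?_ ?_ (by linarith [hn.2])).trans hδ)
      · exact add_nonneg dist_nonneg (hε0 n)
      · exact add_nonneg hδ0.le hδ0.le
    refine ⟨δ, hδ0, h1, fun x y hxy => ?_⟩
    exact le_of_tendsto ((hf x).sub (hf y)).abs (h1.mono fun n hn => hn x y hxy)
  refine ⟨U, f, hU, ?_, fun η hη => ?_⟩
  · refine Metric.continuous_iff.2 fun x η hη => ?_
    obtain ⟨δ, hδ0, -, h⟩ := hclose (η / 2) (half_pos hη)
    exact ⟨δ, hδ0, fun y hy => by
      rw [Real.dist_eq]; linarith [h y x hy]⟩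
  · obtain ⟨δ, hδ0, h1, h2⟩ := hclose (η / 3) (by linarith)
    -- Convergence at the finitely many centres of a cover by `δ`-balls, with equicontinuity, gives
    -- uniform convergence.
    obtain ⟨t, -, ht, hcov⟩ := (isCompact_univ (X := K)).finite_cover_balls hδ0
    have h3 : ∀ᶠ n in (U : Filter ℕ), ∀ z ∈ t, |F n z - f z| < η / 3 := by
      rw [eventually_all_finite ht]
      intro z _
      exact Metric.tendsto_nhds.1 (hf z) (η / 3) (by linarith)
    filter_upwards [h1, h3] with n hn1 hn3 x
    obtain ⟨z, hz, hxz⟩ := Set.mem_iUnion₂.1 (hcov (Set.mem_univ x))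
    rw [Metric.mem_ball] at hxz
    have e1 := abs_le.1 (h2 x z hxz)
    have e2 := abs_le.1 (hn1 x z hxz)
    have e3 := abs_le.1 (hn3 z hz).le
    rw [abs_le]
    constructor <;> linarith [e1.1, e1.2, e2.1, e2.2, e3.1, e3.2]

/-! ### A nonconstant function of finite energy -/

section Nonconstant

variable {K : Type*} [MetricSpace K] [CompactSpace K] [Nontrivial K] [MeasurableSpace K]
  [BorelSpace K] {m : Measure K} [IsProbabilityMeasure m] {df κ p β ϑ R A D S : ℝ}
  {V : ℕ → Type*} [∀ n, Fintype (V n)] {G : ∀ n, SimpleGraph (V n)} {i : ∀ n, K → V n}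

/-- There is a nonconstant continuous function with bounded Korevaar--Schoen energies: a limit of
cut-off functions of a fixed radius on finer and finer nets. -/
theorem exists_nonconstant_ksEnergy_le (hR : 1 < R) (hp : 1 ≤ p) (hA : 1 ≤ A) (hD : 1 ≤ D)
    (hϑ : 0 < ϑ) (hS : 0 < S) (hm : AhlforsBounds m df κ)
    (hi : ∀ n, 1 ≤ n → IsNet m (G n) (i n) df (R ^ n)⁻¹ κ) (hPI : UniformPoincare G p β D A)
    (hcut : UniformCutoff G p ϑ β S) :
    ∃ f : K → ℝ, Continuous f ∧ (¬ ∃ c : ℝ, ∀ᵐ x ∂m, f x = c) ∧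
      ∃ L : ℝ≥0∞, L ≠ ⊤ ∧ ∀ r, 0 < r → r ≤ κ → ksEnergy m p β r f ≤ L := by
  have hκ := hm.one_le
  have hκ0 : 0 < κ := by linarith
  have hp0 : 0 < p := by linarith
  obtain ⟨x₀, y₀, hxy⟩ := exists_pair_ne K
  have hd0 : 0 < dist x₀ y₀ := dist_pos.2 hxy
  -- The constant 6 is chosen so that the support, of graph radius `2a Rⁿ`, with the additive error
  -- of the quasi-isometry absorbed by a third `a Rⁿ`, stays within `3aκ`, half the distance from
  -- `x₀` to `y₀`.
  set a := dist x₀ y₀ / (6 * κ) with ha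
  have ha0 : 0 < a := by positivity
  have haκ : 3 * a * κ = dist x₀ y₀ / 2 := by rw [ha]; field_simp; norm_num
  have hφ : ∀ n : ℕ, ∃ φ : V n → ℝ, 1 ≤ n → 1 ≤ a * R ^ n →
      (∀ x, φ x ∈ Set.Icc (0 : ℝ) 1) ∧
      (∀ x ∈ graphBall (G n) (i n x₀) (a * R ^ n), φ x = 1) ∧
      (Function.support φ ⊆ (graphBall (G n) (i n x₀) (2 * (a * R ^ n)) : Set (V n))) ∧
      energy (G n) p Finset.univ φ
        ≤ S * (((graphBall (G n) (i n x₀) (a * R ^ n)).card : ℝ) / (a * R ^ n) ^ β) ∧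
      ∀ x y, |φ x - φ y| ≤ S * (((G n).dist x y : ℝ) / (a * R ^ n)) ^ ϑ := fun n => by
    by_cases h : 1 ≤ n ∧ 1 ≤ a * R ^ n
    · obtain ⟨φ, h1, h2, h3, h4, h5⟩ := hcut n h.1 (i n x₀) _ h.2
      exact ⟨φ, fun _ _ => ⟨h1, h2, h3, h4, h5⟩⟩
    · exact ⟨0, fun h1 h2 => absurd ⟨h1, h2⟩ h⟩
  choose φ hφ using hφ
  have haR : Tendsto (fun n : ℕ => a * R ^ n) atTop atTop :=
    (tendsto_pow_atTop_atTop_of_one_lt hR).const_mul_atTop ha0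
  -- The bound `κ ≤ a Rⁿ / 2` absorbs the additive constant when the ball on which the limit equals
  -- `1` is identified.
  have hgood : ∀ᶠ n : ℕ in atTop, 1 ≤ n ∧ 1 ≤ a * R ^ n ∧ κ ≤ a * R ^ n / 2 := by
    filter_upwards [eventually_ge_atTop 1, haR.eventually_ge_atTop 1,
      haR.eventually_ge_atTop (2 * κ)] with n h1 h2 h3
    exact ⟨h1, h2, by linarith⟩
  set F : ℕ → K → ℝ := fun n x => φ n (i n x) with hF
  -- The graph distance is at most `κ Rⁿ (dist x y + R⁻ⁿ)`; divided by the radius `a Rⁿ` it gives a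
  -- modulus independent of `n`, with error `R⁻ⁿ` in its argument.
  set H : ℝ → ℝ := fun t => S * (κ / a * t) ^ ϑ with hH
  have hHt : Tendsto H (𝓝 0) (𝓝 0) := by
    have h1 : Tendsto (fun t : ℝ => κ / a * t) (𝓝 0) (𝓝 0) := by
      simpa using (tendsto_id (x := 𝓝 (0 : ℝ))).const_mul (κ / a)
    have h2 := (Real.continuousAt_rpow_const 0 ϑ (Or.inr hϑ.le)).tendsto.comp h1
    rw [Real.zero_rpow hϑ.ne'] at h2
    simpa using h2.const_mul S
  have hHm : MonotoneOn H (Set.Ici 0) := fun s hs t _ hst => by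
    have hs' : 0 ≤ s := hs
    simp only [hH]
    gcongr
  obtain ⟨U, f, hU, hfc, hunif⟩ := exists_ultrafilter_uniform_limit (F := F)
    (hgood.mono fun n hn x => (hφ n hn.1 hn.2.1).1 _) (tendsto_inv_pow_zero hR) hHt hHm
    (fun n => by positivity) (hgood.mono fun n hn x y => by
      refine ((hφ n hn.1 hn.2.1).2.2.2.2 _ _).trans ?_
      have h1 := (hi n hn.1).le_dist x y
      have hRn : 0 < R ^ n := by positivity
      simp only [hH]
      gcongr
      rw [div_le_iff₀ (by positivity)]
      refine h1.trans (le_of_eq ?_)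
      field_simp)
  have hpt : ∀ (x : K) (c : ℝ), (∀ᶠ n in atTop, F n x = c) → f x = c := fun x c h => by
    refine eq_of_forall_dist_le fun η hη => ?_
    obtain ⟨n, hn1, hn2⟩ := ((hunif η hη).and (hU h)).exists
    have := hn1 x
    rwa [hn2] at this
  have hone : ∀ x ∈ Metric.ball x₀ (a / (2 * κ)), f x = 1 := fun x hx => by
    refine hpt x 1 (hgood.mono fun n hn => (hφ n hn.1 hn.2.1).2.1 _ (mem_graphBall.2 ?_))
    have h1 := (hi n hn.1).le_dist x₀ x
    rw [Metric.mem_ball, dist_comm, lt_div_iff₀ (by positivity)] at hx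
    have hRn : 0 < R ^ n := by positivity
    rw [div_inv_eq_mul] at h1
    nlinarith
  have hzero : ∀ x ∈ Metric.ball y₀ (dist x₀ y₀ / 2), f x = 0 := fun x hx => by
    refine hpt x 0 (hgood.mono fun n hn => ?_)
    by_contra hne
    have h1 := (hφ n hn.1 hn.2.1).2.2.1 (Function.mem_support.2 hne)
    rw [Finset.mem_coe, mem_graphBall] at h1
    have h2 := (hi n hn.1).dist_le x₀ x
    rw [Metric.mem_ball] at hx
    have h3 := dist_triangle x₀ x y₀
    have hRn : 0 < R ^ n := by positivity
    have h4 : κ * (R ^ n)⁻¹ * ((G n).dist (i n x₀) (i n x) + 1) ≤ 3 * a * κ := by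
      calc κ * (R ^ n)⁻¹ * ((G n).dist (i n x₀) (i n x) + 1)
          ≤ κ * (R ^ n)⁻¹ * (2 * (a * R ^ n) + a * R ^ n) := by
            gcongr; exact hn.2.1
        _ = _ := by field_simp; norm_num
    linarith
  refine ⟨f, hfc, ?_, ?_⟩
  · rintro ⟨c, hc⟩
    have hball : ∀ x (s : ℝ), 0 < s → m (Metric.ball x s) ≠ 0 := fun x s hs h0 => by
      have := hm.real_ball_pos x hs
      simp [Measure.real, h0] at this
    have hex : ∀ s : Set K, m s ≠ 0 → ∃ x ∈ s, f x = c := fun s hs => by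
      by_contra! h
      exact hs (measure_mono_null (fun x hx => h x hx) (ae_iff.1 hc))
    obtain ⟨x, hx, hxc⟩ := hex _ (hball x₀ (a / (2 * κ)) (by positivity))
    obtain ⟨y, hy, hyc⟩ := hex _ (hball y₀ (dist x₀ y₀ / 2) (by positivity))
    rw [hone x hx] at hxc
    rw [hzero y hy] at hyc
    linarith
  · set Q := 2 ^ (p + 1) * κ ^ 6 * (κ ^ df) ^ 2 * ((4 * A * κ) ^ df) ^ 2 * (D * (4 * κ) ^ β)
    set c := ENNReal.ofReal (4 ^ p * (κ ^ 2 * κ ^ df))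
    -- The ball of graph radius `a Rⁿ` has at most `κ (a Rⁿ) ^ df` vertices, so the normalized
    -- energy of the cut-off is at most `S κ a ^ (df - β)`: the powers of `Rⁿ` cancel and `L`
    -- depends neither on `n` nor on `r`.
    set L := c * ENNReal.ofReal (Q * (S * (κ * (a ^ df / a ^ β)))) with hL
    refine ⟨L, by finiteness, fun r hr hrκ => ?_⟩
    set B : ℝ≥0∞ := ENNReal.ofReal (((r / κ) ^ df / κ * r ^ β)⁻¹) * ENNReal.ofReal (4 ^ p) * 2
    have hB : B ≠ ⊤ := by finiteness
    have hle : ∀ η : ℝ, 0 < η → ksEnergy m p β r f ≤ L + B * ENNReal.ofReal (η ^ p) :=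
      fun η hη => by
      obtain ⟨n, ⟨hn, hnr⟩, hnη⟩ := (((hgood.and ((tendsto_inv_pow_zero hR).eventually
        (ge_mem_nhds hr))).filter_mono hU).and (hunif η hη)).exists
      have hRn : 0 < R ^ n := by positivity
      refine (hm.ksEnergy_le_add hp0.le hr hrκ hfc.measurable (measurable_comp_fiber
        (hi n hn.1).measurableSet_fiber (φ n))).trans ?_
      refine add_le_add ?_ ?_
      · rw [hL]
        gcongr
        refine ((hi n hn.1).ksEnergy_comp_le hm hp0.le (by positivity) hA
          (by linarith) (hPI n hn.1) hnr hrκ (φ n)).trans (ENNReal.ofReal_le_ofReal ?_)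
        refine mul_le_mul_of_nonneg_left ?_ (by positivity)
        have h1 := (hφ n hn.1 hn.2.1).2.2.2.1
        have h2 := (hi n hn.1).card_le (i n x₀) _ hn.2.1
        have h3 : energy (G n) p Finset.univ (φ n)
            ≤ S * (κ * (a * R ^ n) ^ df / (a * R ^ n) ^ β) := h1.trans (by gcongr)
        refine (mul_le_mul_of_nonneg_left h3 (by positivity)).trans (le_of_eq ?_)
        have e1 : 0 < (R ^ n) ^ df := by positivity
        have e2 : 0 < (R ^ n) ^ β := by positivity
        have e3 : 0 < a ^ β := by positivity
        rw [Real.inv_rpow hRn.le, Real.inv_rpow hRn.le, Real.mul_rpow ha0.le hRn.le,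
          Real.mul_rpow ha0.le hRn.le]
        field_simp
      · refine mul_le_mul_right ?_ B
        calc _ ≤ ∫⁻ _x : K, ENNReal.ofReal (η ^ p) ∂m := by
              refine lintegral_mono fun x => ENNReal.ofReal_le_ofReal ?_
              exact Real.rpow_le_rpow (abs_nonneg _) (hnη x) hp0.le
          _ = _ := by simp
    have ht : Tendsto (fun η : ℝ => L + B * ENNReal.ofReal (η ^ p)) (𝓝[>] 0) (𝓝 (L + B * 0)) := by
      have h1 : Tendsto (fun η : ℝ => η ^ p) (𝓝 0) (𝓝 (0 ^ p)) :=
        (Real.continuousAt_rpow_const 0 p (Or.inr hp0.le)).tendsto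
      rw [Real.zero_rpow hp0.ne'] at h1
      have h2 := ENNReal.tendsto_ofReal (h1.mono_left (nhdsWithin_le_nhds (s := Set.Ioi 0)))
      rw [ENNReal.ofReal_zero] at h2
      exact tendsto_const_nhds.add (ENNReal.Tendsto.const_mul h2 (Or.inr hB))
    rw [mul_zero, add_zero] at ht
    exact ge_of_tendsto ht (eventually_mem_nhdsWithin.mono fun η hη => hle η hη)

end Nonconstant

/-! ### Two-sided comparison and the critical exponent -/

section Main

variable {K : Type*} [MeasurableSpace K] {m : Measure K} {df κ p β R : ℝ} {f : K → ℝ}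
  {V : ℕ → Type*} [∀ n, Fintype (V n)] {G : ∀ n, SimpleGraph (V n)} {cell : ∀ n, V n → Set K}

theorem sobolevSeminorm_rpow (hp : 0 < p) :
    sobolevSeminorm m G cell p df β R f ^ p
      = ⨆ (n : ℕ) (_ : 1 ≤ n), ENNReal.ofReal (normalizedEnergy m G cell p df β R n f) := by
  rw [sobolevSeminorm, ← ENNReal.rpow_mul, one_div_mul_cancel hp.ne', ENNReal.rpow_one]

theorem normalizedEnergy_eq (hR : 0 < R) (n : ℕ) :
    normalizedEnergy m G cell p df β R n f = ((R ^ n)⁻¹) ^ df / ((R ^ n)⁻¹) ^ β *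
      energy (G n) p Finset.univ fun v => ⨍ x in cell n v, f x ∂m := by
  have hRn : 0 < R ^ n := by positivity
  rw [normalizedEnergy, Real.rpow_mul hR.le, Real.rpow_natCast, Real.rpow_sub hRn,
    Real.inv_rpow hRn.le, Real.inv_rpow hRn.le]
  congr 1
  have h1 : 0 < (R ^ n) ^ β := by positivity
  have h2 : 0 < (R ^ n) ^ df := by positivity
  field_simp

variable [MetricSpace K]

theorem ksEnergy_eq_mul_ksEnergy {b b' r : ℝ} (hr : 0 < r) :
    ksEnergy m p b r f = ENNReal.ofReal (r ^ (b' - b)) * ksEnergy m p b' r f := by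
  unfold ksEnergy
  rw [← lintegral_const_mul' _ _ ENNReal.ofReal_ne_top]
  refine lintegral_congr fun x => ?_
  have h1 : 0 < r ^ b := by positivity
  have h2 : 0 < r ^ b' := by positivity
  rw [laverage_ball_eq hr, laverage_ball_eq hr, ← ENNReal.ofReal_inv_of_pos h1,
    ← ENNReal.ofReal_inv_of_pos h2]
  have e : ENNReal.ofReal (r ^ b)⁻¹
      = ENNReal.ofReal (r ^ (b' - b)) * ENNReal.ofReal (r ^ b')⁻¹ := by
    rw [← ENNReal.ofReal_mul (by positivity), Real.rpow_sub hr]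
    congr 1; field_simp
  rw [e]; ring

/-- With balls equal to the whole space, `|f x - f y| ^ p` has zero integral over all pairs. For
almost every `x`, and so for some `x`, the slice vanishes almost everywhere. -/
theorem exists_ae_eq_const_of_ksEnergy_eq_zero [IsProbabilityMeasure m] {b r : ℝ}
    (hf : Measurable f) (hr : 0 < r) (hd : ∀ x y : K, dist x y < r)
    (h : ksEnergy m p b r f = 0) : ∃ c : ℝ, ∀ᵐ x ∂m, f x = c := by
  have huniv : ∀ x : K, Metric.ball x r = Set.univ := fun x =>
    Set.eq_univ_of_forall fun y => hd y x
  have h1 := ksIntegral_le_ksEnergy (m := m) (p := p) (b := b) (f := f) hr zero_le_one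
    (fun x => by simp [huniv x]) (fun x => by simp [huniv x])
  rw [h, mul_zero, nonpos_iff_eq_zero] at h1
  unfold ksIntegral at h1
  simp only [huniv, Measure.restrict_univ] at h1
  have hmeas : Measurable fun z : K × K => ENNReal.ofReal (|f z.1 - f z.2| ^ p) :=
    ((((hf.comp measurable_fst).sub (hf.comp measurable_snd)).abs).pow_const p).ennreal_ofReal
  rw [lintegral_eq_zero_iff hmeas.lintegral_prod_right'] at h1
  obtain ⟨x, hx⟩ := h1.exists
  have hmx : Measurable fun y => ENNReal.ofReal (|f x - f y| ^ p) :=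
    (((hf.const_sub (f x)).abs).pow_const p).ennreal_ofReal
  rw [Pi.zero_apply, lintegral_eq_zero_iff hmx] at hx
  refine ⟨f x, hx.mono fun y hy => ?_⟩
  simp only [Pi.zero_apply, ENNReal.ofReal_eq_zero] at hy
  by_contra hne
  have h3 : 0 < |f x - f y| := abs_pos.2 (sub_ne_zero.2 fun h => hne h.symm)
  have : 0 < |f x - f y| ^ p := by positivity
  linarith

theorem iSup_ksEnergy_le_iSup {b : ℝ} :
    (⨆ (r : ℝ) (_ : 0 < r ∧ ENNReal.ofReal r ≤ Metric.ediam (Set.univ : Set K)),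
        ksEnergy m p b r f) ≤ ⨆ (r : ℝ) (_ : 0 < r), ksEnergy m p b r f :=
  iSup₂_le fun r hr => le_iSup₂ (f := fun (r : ℝ) (_ : 0 < r) => ksEnergy m p b r f) r hr.1

variable [CompactSpace K]

theorem liminf_ksEnergy_le_iSup [Nontrivial K] {b : ℝ} :
    liminf (fun r : ℝ => ksEnergy m p b r f) (𝓝[>] 0)
      ≤ ⨆ (r : ℝ) (_ : 0 < r ∧ ENNReal.ofReal r ≤ Metric.ediam (Set.univ : Set K)),
        ksEnergy m p b r f := by
  have hD : 0 < Metric.diam (Set.univ : Set K) :=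
    Metric.diam_pos Set.nontrivial_univ isCompact_univ.isBounded
  calc _ ≤ liminf (fun _ : ℝ => _) (𝓝[>] (0 : ℝ)) := by
        refine liminf_le_liminf ?_
        filter_upwards [Ioo_mem_nhdsGT hD] with r hr
        exact le_iSup₂ (f := fun (r : ℝ) (_ : 0 < r ∧ ENNReal.ofReal r
          ≤ Metric.ediam (Set.univ : Set K)) => ksEnergy m p b r f) r
          ⟨hr.1, ENNReal.ofReal_le_of_le_toReal hr.2.le⟩
    _ = _ := liminf_const _

/-- Changing the order from `b'` to `b` multiplies the energy by `r ^ (b' - b)`, which tends to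
zero. -/
theorem tendsto_ksEnergy_zero {b b' : ℝ} (hb : b < b') [Nontrivial K]
    (h : (⨆ (r : ℝ) (_ : 0 < r ∧ ENNReal.ofReal r ≤ Metric.ediam (Set.univ : Set K)),
      ksEnergy m p b' r f) ≠ ⊤) :
    Tendsto (fun r : ℝ => ksEnergy m p b r f) (𝓝[>] 0) (𝓝 0) := by
  set S := ⨆ (r : ℝ) (_ : 0 < r ∧ ENNReal.ofReal r ≤ Metric.ediam (Set.univ : Set K)),
      ksEnergy m p b' r f with hS
  have hb' : 0 < b' - b := by linarith
  have h1 : Tendsto (fun r : ℝ => r ^ (b' - b)) (𝓝 0) (𝓝 (0 ^ (b' - b))) :=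
    (Real.continuousAt_rpow_const 0 _ (Or.inr hb'.le)).tendsto
  rw [Real.zero_rpow hb'.ne'] at h1
  have h2 := ENNReal.tendsto_ofReal (h1.mono_left (nhdsWithin_le_nhds (s := Set.Ioi 0)))
  rw [ENNReal.ofReal_zero] at h2
  have h3 := ENNReal.Tendsto.mul_const h2 (Or.inr h)
  rw [zero_mul] at h3
  refine tendsto_of_tendsto_of_tendsto_of_le_of_le' tendsto_const_nhds h3
    (Eventually.of_forall fun _ => zero_le) ?_
  have hD : 0 < Metric.diam (Set.univ : Set K) :=
    Metric.diam_pos Set.nontrivial_univ isCompact_univ.isBounded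
  filter_upwards [Ioo_mem_nhdsGT hD] with r hr
  rw [ksEnergy_eq_mul_ksEnergy (b' := b') hr.1]
  refine mul_le_mul_right ?_ _
  exact le_iSup₂ (f := fun (r : ℝ) (_ : 0 < r ∧ ENNReal.ofReal r
          ≤ Metric.ediam (Set.univ : Set K)) => ksEnergy m p b' r f) r
          ⟨hr.1, ENNReal.ofReal_le_of_le_toReal hr.2.le⟩

variable [IsProbabilityMeasure m]

/-- The critical exponent is `β / p` if the Korevaar--Schoen energies of order `β` enjoy the weak
monotonicity property and those of some nonconstant function are bounded. -/
theorem criticalExponent_eq [Nontrivial K] {C : ℝ≥0∞} (hp : 0 < p) (hβ : 0 < β)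
    (hm : AhlforsBounds m df κ)
    (hweak : ∀ f : Lp ℝ (ENNReal.ofReal p) m, (⨆ (r : ℝ) (_ : 0 < r), ksEnergy m p β r f)
      ≤ C * liminf (fun r : ℝ => ksEnergy m p β r f) (𝓝[>] 0))
    (hex : ∃ f ∈ besovLipschitz m p (β / p), ¬ ∃ c : ℝ, ∀ᵐ x ∂m, f x = c) :
    criticalExponent m p = ENNReal.ofReal (β / p) := by
  refine le_antisymm (iSup₂_le fun s ⟨_, f, hf, hnc⟩ => ?_) ?_
  · refine ENNReal.ofReal_le_ofReal (le_of_not_gt fun hlt => hnc ?_)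
    have h1 := tendsto_ksEnergy_zero (b := β) ((div_lt_iff₀ hp).1 hlt) (ne_of_lt hf)
    -- A vanishing lower limit forces the energy to vanish at every scale, in particular at `κ`,
    -- which exceeds all distances.
    have h2 := hweak f
    rw [h1.liminf_eq, mul_zero] at h2
    have hκ0 : 0 < κ := lt_of_lt_of_le one_pos hm.one_le
    refine exists_ae_eq_const_of_ksEnergy_eq_zero (p := p) (b := β)
      (Lp.stronglyMeasurable f).measurable
      hκ0 hm.dist_lt (le_antisymm (le_trans ?_ h2) zero_le)
    exact le_iSup₂ (f := fun (r : ℝ) (_ : 0 < r) => ksEnergy m p β r f) κ hκ0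
  · exact le_iSup₂ (f := fun (s : ℝ) (_ : 0 < s ∧ ∃ f ∈ besovLipschitz m p s,
      ¬ ∃ c : ℝ, ∀ᵐ x ∂m, f x = c) => ENNReal.ofReal s) (β / p) ⟨by positivity, hex⟩

variable [BorelSpace K] {i : ∀ n, K → V n} {A D : ℝ}

/-- The two basic inequalities are chained here: `hlow` compares level `n` with radii of order
`R⁻ⁿ`, and `hup` bounds every radius by the lower limit over levels. The first bound uses `hlow`
twice, whence the two factors `C₁`. -/
theorem sobolevSeminorm_le_and_iSup_ksEnergy_le (hR : 1 < R) (hp : 1 ≤ p) (hA : 1 ≤ A) (hD : 1 ≤ D)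
    (hdf : 0 ≤ df) (hβ : 0 ≤ β) (hm : AhlforsBounds m df κ)
    (hi : ∀ n, 1 ≤ n → IsNet m (G n) (i n) df (R ^ n)⁻¹ κ) (hPI : UniformPoincare G p β D A)
    (hcell : ∀ n, 1 ≤ n → ∀ v, i n ⁻¹' {v} = cell n v) {C₁ C₂ : ℝ}
    (hC₁ : C₁ = κ ^ 3 * ((3 * κ * R) ^ df * (3 * κ * R) ^ β))
    (hC₂ : C₂ = 4 ^ p * (κ ^ 2 * κ ^ df) *
      (2 ^ (p + 1) * κ ^ 6 * (κ ^ df) ^ 2 * ((4 * A * κ) ^ df) ^ 2 * (D * (4 * κ) ^ β)))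
    (hfm : Measurable f) (hf : MemLp f (ENNReal.ofReal p) m) :
    sobolevSeminorm m G cell p df β R f ^ p ≤ ENNReal.ofReal (C₁ * C₂ * C₁) *
        liminf (fun r : ℝ => ksEnergy m p β r f) (𝓝[>] 0) ∧
      (⨆ (r : ℝ) (_ : 0 < r), ksEnergy m p β r f)
        ≤ ENNReal.ofReal C₂ * sobolevSeminorm m G cell p df β R f ^ p := by
  have hκ := hm.one_le
  have hκ0 : 0 < κ := by linarith
  have hR0 : 0 < R := by linarith
  have hC₁0 : 0 < C₁ := by rw [hC₁]; positivity
  have hC₂0 : 0 < C₂ := by rw [hC₂]; positivity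
  have hfi : Integrable f m := hf.integrable (by simpa using hp)
  rw [sobolevSeminorm_rpow (by linarith)]
  set e : ℕ → ℝ≥0∞ := fun n => ENNReal.ofReal (normalizedEnergy m G cell p df β R n f) with he
  set F : ℝ → ℝ≥0∞ := fun r => ksEnergy m p β r f with hF
  have heq : ∀ n, 1 ≤ n → e n = ENNReal.ofReal (((R ^ n)⁻¹) ^ df / ((R ^ n)⁻¹) ^ β *
      energy (G n) p Finset.univ fun v => ⨍ x in i n ⁻¹' {v}, f x ∂m) := fun n hn => by
    simp only [he]
    rw [normalizedEnergy_eq hR0]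
    simp_rw [hcell n hn]
  have hlow : ∀ n, 1 ≤ n → ∀ r, 3 * κ * (R ^ n)⁻¹ ≤ r → r ≤ 3 * κ * R * (R ^ n)⁻¹ →
      e n ≤ ENNReal.ofReal C₁ * F r := fun n hn r hr1 hr2 => by
    rw [heq n hn, hC₁]
    exact (hi n hn).energy_average_le_ksEnergy hm hp hdf hβ (by positivity) hr1 hr2 hfm hfi
  have hup : ∀ r, 0 < r → F r ≤ ENNReal.ofReal C₂ * liminf e atTop := fun r hr => by
    have h1 := ksEnergy_le_liminf hR hp hA hD hβ hm hi hPI hfm hf hr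
    rw [← mul_assoc, ← ENNReal.ofReal_mul (by positivity), ← hC₂] at h1
    refine h1.trans (le_of_eq ?_)
    congr 1
    refine liminf_congr ?_
    filter_upwards [eventually_ge_atTop 1] with n hn
    rw [heq n hn]
  have hlim : liminf e atTop ≤ ENNReal.ofReal C₁ * liminf F (𝓝[>] 0) :=
    liminf_nat_le_liminf_nhdsGT hR (by positivity : 0 < 3 * κ)
      (by rwa [Ne, ENNReal.ofReal_eq_zero, not_le]) ENNReal.ofReal_ne_top hlow
  constructor
  · refine iSup₂_le fun n hn => ?_
    have hr : 0 < 3 * κ * (R ^ n)⁻¹ := by positivity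
    calc e n ≤ ENNReal.ofReal C₁ * F (3 * κ * (R ^ n)⁻¹) := hlow n hn _ le_rfl (by
          calc _ ≤ 3 * κ * (R ^ n)⁻¹ * R := le_mul_of_one_le_right hr.le hR.le
            _ = _ := by ring)
      _ ≤ ENNReal.ofReal C₁ * (ENNReal.ofReal C₂ * (ENNReal.ofReal C₁ * liminf F (𝓝[>] 0))) := by
          gcongr
          exact (hup _ hr).trans (by gcongr)
      _ = _ := by
          rw [ENNReal.ofReal_mul (by positivity), ENNReal.ofReal_mul (by positivity)]; ring
  · refine iSup₂_le fun r hr => (hup r hr).trans ?_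
    gcongr
    calc liminf e atTop ≤ liminf (fun _ : ℕ => ⨆ (n : ℕ) (_ : 1 ≤ n), e n) atTop := by
          refine liminf_le_liminf ?_
          filter_upwards [eventually_ge_atTop 1] with n hn
          exact le_iSup₂ (f := fun (n : ℕ) (_ : 1 ≤ n) => e n) n hn
      _ = _ := liminf_const _

theorem exists_mem_besovLipschitz (hp : 0 < p) (hm : AhlforsBounds m df κ) (hfc : Continuous f)
    (hnc : ¬ ∃ c : ℝ, ∀ᵐ x ∂m, f x = c) {L : ℝ≥0∞} (hL : L ≠ ⊤)
    (hf : ∀ r, 0 < r → r ≤ κ → ksEnergy m p β r f ≤ L) :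
    ∃ f ∈ besovLipschitz m p (β / p), ¬ ∃ c : ℝ, ∀ᵐ x ∂m, f x = c := by
  obtain ⟨B, hB⟩ := isCompact_univ.exists_bound_of_continuousOn hfc.continuousOn
  have hmem : MemLp f (ENNReal.ofReal p) m := MemLp.of_bound hfc.aestronglyMeasurable B
    (Eventually.of_forall fun x => hB x (Set.mem_univ x))
  refine ⟨hmem.toLp, lt_of_le_of_lt (iSup₂_le fun r hr => ?_) hL.lt_top, fun ⟨c, hc⟩ => hnc ⟨c, ?_⟩⟩
  · rw [ksEnergy_congr_ae hmem.coeFn_toLp, div_mul_cancel₀ _ hp.ne']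
    refine hf r hr.1 ?_
    have h1 : r ≤ Metric.diam (Set.univ : Set K) :=
      (ENNReal.ofReal_le_iff_le_toReal isCompact_univ.isBounded.ediam_ne_top).1 hr.2
    exact h1.trans (Metric.diam_le_of_forall_dist_le (by linarith [hm.one_le])
      fun x _ y _ => (hm.dist_lt x y).le)
  · filter_upwards [hc, hmem.coeFn_toLp] with x h1 h2
    rw [← h2, h1]

end Main

end GraphSobolev

/-! ### Assembly of the theorem -/

theorem theorem7p1 (p df β ϑ R CAR A₁ A₂ Ccomp CPI API CCF : ℝ)
    (hp : 1 < p) (hdf : 1 ≤ df) (hβ : 0 < β) (hϑ₀ : 0 < ϑ) (hϑ₁ : ϑ ≤ 1) (hR : 1 < R)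
    (hCAR : 1 ≤ CAR) (hA₁ : 1 < A₁) (hA₂ : 1 < A₂) (hCcomp : 1 ≤ Ccomp)
    (hCPI : 1 ≤ CPI) (hAPI : 1 ≤ API) (hCCF : 0 < CCF) :
    ∃ C : ℝ, 1 ≤ C ∧
      ∀ (K : Type*) [MetricSpace K] [CompactSpace K] [ConnectedSpace K] [Nontrivial K]
        [MeasurableSpace K] [BorelSpace K] (m : Measure K) [IsProbabilityMeasure m]
        (V : ℕ → Type*) [∀ n, Fintype (V n)] (G : ∀ n, SimpleGraph (V n))
        (proj : ∀ n k : ℕ, V n → V k) (pt : ∀ n, V n → K) (cell : ∀ n, V n → Set K),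
        GraphSobolev.IsAhlforsRegular m df CAR →
        (∀ n : ℕ, 1 ≤ n → (G n).Connected) →
        GraphSobolev.IsProjective proj →
        GraphSobolev.IsScaled G proj R A₁ A₂ →
        GraphSobolev.IsCompatible G proj pt cell R Ccomp →
        GraphSobolev.UniformPoincare G p β CPI API →
        GraphSobolev.UniformCutoff G p ϑ β CCF →
        (∀ f : Lp ℝ (ENNReal.ofReal p) m,
          (ENNReal.ofReal C)⁻¹ * GraphSobolev.sobolevSeminorm m G cell p df β R f ^ p
              ≤ liminf (fun r : ℝ => GraphSobolev.ksEnergy m p β r f) (𝓝[>] 0) ∧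
          liminf (fun r : ℝ => GraphSobolev.ksEnergy m p β r f) (𝓝[>] 0)
              ≤ (⨆ (r : ℝ) (_ : 0 < r), GraphSobolev.ksEnergy m p β r f) ∧
          (⨆ (r : ℝ) (_ : 0 < r), GraphSobolev.ksEnergy m p β r f)
              ≤ ENNReal.ofReal C * GraphSobolev.sobolevSeminorm m G cell p df β R f ^ p) ∧
        GraphSobolev.sobolevSpace m G cell p df β R = GraphSobolev.besovLipschitz m p (β / p) ∧
        (∀ f : Lp ℝ (ENNReal.ofReal p) m,
          (⨆ (r : ℝ) (_ : 0 < r), GraphSobolev.ksEnergy m p β r f)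
            ≤ ENNReal.ofReal (C ^ 2) *
              liminf (fun r : ℝ => GraphSobolev.ksEnergy m p β r f) (𝓝[>] 0)) ∧
        GraphSobolev.criticalExponent m p = ENNReal.ofReal (β / p) := by
  obtain ⟨κ₀, hκ₀, hahl⟩ := GraphSobolev.exists_ahlforsBounds (A := CAR) hdf hR hCAR hCcomp
  set κ := κ₀ ^ 2 * (2 * Ccomp ^ 2) ^ df with hκ
  set C₁ := κ ^ 3 * ((3 * κ * R) ^ df * (3 * κ * R) ^ β) with hC₁
  set C₂ := 4 ^ p * (κ ^ 2 * κ ^ df) *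
    (2 ^ (p + 1) * κ ^ 6 * (κ ^ df) ^ 2 * ((4 * API * κ) ^ df) ^ 2 * (CPI * (4 * κ) ^ β)) with hC₂
  have hκκ : κ₀ ≤ κ := by
    have h1 : 1 ≤ (2 * Ccomp ^ 2) ^ df :=
      Real.one_le_rpow (by nlinarith) (by linarith)
    calc κ₀ ≤ κ₀ ^ 2 := by nlinarith
      _ ≤ κ := le_mul_of_one_le_right (by positivity) h1
  have hκ0 : 0 < κ := by linarith
  have hC₁0 : 0 < C₁ := by positivity
  have hC₂0 : 0 < C₂ := by positivity
  have hC₁₂ : 0 < C₁ * C₂ * C₁ := by positivity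
  -- One constant dominating both bounds and `1`, fixed before the space and the graphs are
  -- introduced.
  set C := 1 + C₁ * C₂ * C₁ + C₂ with hC
  have hC1 : 1 ≤ C := by linarith
  refine ⟨C, hC1, ?_⟩
  intro K _ _ _ _ _ _ m _ V _ G proj pt cell hreg hG _ _ hcomp hPI hcut
  have hm₀ := hahl K m V G proj pt cell hreg hG hcomp
  have hm := hm₀.mono hκκ
  -- The hypotheses say nothing about `V 0`, which may be empty: it is replaced by `V 1`.
  have hlev : ∀ n, GraphSobolev.IsLevel (G (n - 1 + 1)) (pt (n - 1 + 1)) (cell (n - 1 + 1))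
      (R ^ (n - 1 + 1))⁻¹ Ccomp := fun n => hcomp.isLevel hCcomp (by omega)
  choose i hi using fun n => (hlev n).exists_mem
  have hnet : ∀ n, 1 ≤ n →
      GraphSobolev.IsNet m (G (n - 1 + 1)) (i n) df (R ^ n)⁻¹ κ := fun n hn => by
    have hpow : R ^ n = R ^ (n - 1 + 1) := by rw [Nat.sub_add_cancel hn]
    rw [hpow]
    exact (hlev n).isNet (hG _ (by omega)) (by positivity)
      (inv_le_one_of_one_le₀ (one_le_pow₀ hR.le)) hCcomp hdf hm₀ (hi n)
  have hPI' : GraphSobolev.UniformPoincare (V := fun n => V (n - 1 + 1))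
      (fun n => G (n - 1 + 1)) p β CPI API := fun n _ => hPI (n - 1 + 1) (by omega)
  have hcut' : GraphSobolev.UniformCutoff (V := fun n => V (n - 1 + 1))
      (fun n => G (n - 1 + 1)) p ϑ β CCF := fun n _ => hcut (n - 1 + 1) (by omega)
  have hnorm : ∀ f : K → ℝ, GraphSobolev.sobolevSeminorm (V := fun n => V (n - 1 + 1)) m
      (fun n => G (n - 1 + 1)) (fun n => cell (n - 1 + 1)) p df β R f
        = GraphSobolev.sobolevSeminorm m G cell p df β R f := fun f => by
    unfold GraphSobolev.sobolevSeminorm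
    congr 1
    refine iSup_congr fun n => iSup_congr fun hn => ?_
    -- Only levels `n ≥ 1` enter the supremum; for `n = k + 1` the shifted index reduces to `n` by
    -- definition.
    obtain ⟨k, rfl⟩ := Nat.exists_eq_add_of_le' hn
    rfl
  have hmain : ∀ f : Lp ℝ (ENNReal.ofReal p) m,
      GraphSobolev.sobolevSeminorm m G cell p df β R f ^ p ≤ ENNReal.ofReal C *
        liminf (fun r : ℝ => GraphSobolev.ksEnergy m p β r f) (𝓝[>] 0) ∧
      (⨆ (r : ℝ) (_ : 0 < r), GraphSobolev.ksEnergy m p β r f)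
        ≤ ENNReal.ofReal C * GraphSobolev.sobolevSeminorm m G cell p df β R f ^ p := fun f => by
    obtain ⟨h1, h2⟩ := GraphSobolev.sobolevSeminorm_le_and_iSup_ksEnergy_le
      (cell := fun n => cell (n - 1 + 1)) hR hp.le hAPI hCPI (by linarith) hβ.le hm hnet hPI'
      (fun n _ => (hlev n).preimage_eq (hi n)) hC₁ hC₂ (Lp.stronglyMeasurable f).measurable
      (Lp.memLp f)
    rw [hnorm] at h1 h2
    exact ⟨h1.trans (by gcongr; linarith), h2.trans (by gcongr; linarith)⟩
  have hCne : ENNReal.ofReal C ≠ 0 := by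
    rw [Ne, ENNReal.ofReal_eq_zero]; linarith
  have hls : ∀ f : Lp ℝ (ENNReal.ofReal p) m,
      liminf (fun r : ℝ => GraphSobolev.ksEnergy m p β r f) (𝓝[>] 0)
        ≤ ⨆ (r : ℝ) (_ : 0 < r), GraphSobolev.ksEnergy m p β r f := fun f =>
    GraphSobolev.liminf_ksEnergy_le_iSup.trans GraphSobolev.iSup_ksEnergy_le_iSup
  have hweak : ∀ f : Lp ℝ (ENNReal.ofReal p) m,
      (⨆ (r : ℝ) (_ : 0 < r), GraphSobolev.ksEnergy m p β r f) ≤ ENNReal.ofReal (C ^ 2) *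
        liminf (fun r : ℝ => GraphSobolev.ksEnergy m p β r f) (𝓝[>] 0) := fun f => by
    rw [pow_two, ENNReal.ofReal_mul (by linarith), mul_assoc]
    exact (hmain f).2.trans (by gcongr; exact (hmain f).1)
  refine ⟨fun f => ⟨?_, hls f, (hmain f).2⟩, ?_, hweak, ?_⟩
  · rw [← ENNReal.div_eq_inv_mul]
    exact ENNReal.div_le_of_le_mul' (hmain f).1
  · ext f
    have hp0 : 0 < p := by linarith
    have hS := GraphSobolev.sobolevSeminorm_rpow (m := m) (G := G) (cell := cell) (df := df)
      (β := β) (R := R) (f := f) hp0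
    simp only [GraphSobolev.sobolevSpace, GraphSobolev.besovLipschitz, Set.mem_ofPred_eq,
      div_mul_cancel₀ _ hp0.ne', ← hS]
    -- The Besov supremum runs only over radii up to the diameter, and so lies between the lower
    -- limit at zero and the supremum over all radii, both comparable to the seminorm.
    constructor <;> intro h
    · exact (GraphSobolev.iSup_ksEnergy_le_iSup.trans (hmain f).2).trans_lt
        (ENNReal.mul_lt_top ENNReal.ofReal_lt_top h)
    · exact ((hmain f).1.trans (by gcongr; exact GraphSobolev.liminf_ksEnergy_le_iSup)).trans_lt
        (ENNReal.mul_lt_top ENNReal.ofReal_lt_top h)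
  · obtain ⟨f, hfc, hnc, L, hL, hfL⟩ := GraphSobolev.exists_nonconstant_ksEnergy_le hR hp.le hAPI
      hCPI hϑ₀ hCCF hm hnet hPI' hcut'
    exact GraphSobolev.criticalExponent_eq (by linarith) hβ hm hweak
      (GraphSobolev.exists_mem_besovLipschitz (by linarith) hm hfc hnc hL hfL)
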